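/- Let $V^*$ be a finite set of receiver nodes, let $k\ge 1$, and let $\vec G$ be a directed graph without self-loops on $V^*\cup\{0\}$, where node $0$ is the source. Let $\mathcal N_j^+\subseteq V^*$ be the set of receiver nodes with an edge to $j$, and $n_j=|\mathcal N_j^+|$. Assume that $\vec G$ is $(k,n)$-TSS feasible: node $0$ has an edge to every receiver node, and every receiver node has in-degree greater than $k$ in $\vec G$ (the edge from the source included, so that $n_j\ge k$). The source is updated at the jump times $\tau_1<\tau_2<\cdots$ of a Poisson counter $N_0(t)$ of rate $\lambda_s>0$, with $\tau_0=0$. The edge $e_{ij}$ between receiver nodes $i,j$ is activated at the jump times of a Poisson counter $N^{ij}(t)$ of rate $\lambda_{ij}>0$. All these counters are (mutually) independent. In full subscription, $n=|V^*|$, and at each time $\tau_\ell$ the source makes $n$ distinct keys of version $\ell$ and sends each receiver node one key of its own. In the memory scheme, when $e_{ij}$ is activated at time $t$, node $i$ sends to node $j$ all the keys that the source has sent to node $i$ since the last activation of $e_{ij}$ before $t$ (since time $0$ if there is none); nodes never pass on keys received from other receiver nodes. A node can decode version $\ell$ once it holds at least $k+1$ keys of version $\ell$. Let $N_j^k(t)$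 be the latest version that node $j$ can decode at time $t$ ($0$ if there is none), and let $A_j(k,t)=N_0(t)-N_j^k(t)$ be the $k$-keys version age of node $j$. Let $U=\tau_{\ell+1}-\tau_\ell$ be an interarrival time of the source updates (for any fixed $\ell\ge 0$), and for $i\in\mathcal N_j^+$ let $X_{ij}$ be an interarrival time of the activations of $e_{ij}$ (with any fixed index, the first one being counted from time $0$); so $X_{ij}$ is exponential with mean $1/\lambda_{ij}$. Let $\mathcal X_{(k:n_j)}$ be the $k$-th smallest of the $n_j$ random variables $X_{ij}$, $i\in\mathcal N^+_j$. Theorem. For every receiver node $j$, $U$ and $\mathcal X_{(k:n_j)}$ are integrable, $\mathbb E[U]>0$, and with probability $1$ the path $t\mapsto A_j(k,t)$ is integrable on bounded intervals and the time average of the $k$-keys version age of node $j$ exists and equals $$\Delta_j(k)=\lim_{t\to\infty}\frac1t\int_0^t A_j(k,\tau)\,d\tau=\frac{\mathbb E[\mathcal X_{(k:n_j)}]}{\mathbb E[U]}.$$ -/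

import Mathlib

open MeasureTheory ProbabilityTheory Filter Topology
open scoped NNReal

noncomputable section

namespace GossipAge

/-- `N` is a Poisson counter of rate `r` on `[0, ∞)`: almost every path starts at `0`, is
nondecreasing and right-continuous, the increments over disjoint intervals are independent, and the
increment over `(s, t]` has the Poisson law of mean `r * (t - s)`. -/
structure IsPoissonCounter {Ω : Type*} [MeasurableSpace Ω] (N : ℝ≥0 → Ω → ℕ) (r : ℝ≥0)
    (P : Measure Ω) : Prop where
  measurable : ∀ t, Measurable (N t)
  path_zero : ∀ᵐ ω ∂P, N 0 ω = 0
  path_mono : ∀ᵐ ω ∂P, Monotone fun t => N t ω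
  path_rightCts : ∀ᵐ ω ∂P, ∀ t, ContinuousWithinAt (fun s => N s ω) (Set.Ici t) t
  indep_increments : HasIndepIncrements N P
  increment_law : ∀ s t, s ≤ t →
    HasLaw (fun ω => N t ω - N s ω) (poissonMeasure (r * (t - s))) P

/-- The time of the `l`-th jump of the counting path `c` (it is `0` for `l = 0`). -/
def eventTime (c : ℝ≥0 → ℕ) (l : ℕ) : ℝ≥0 := sInf {t | l ≤ c t}

/-- The time between the `l`-th and the `(l + 1)`-st jump of the counting path `c`. -/
def interarrival (c : ℝ≥0 → ℕ) (l : ℕ) : ℝ :=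
  (eventTime c (l + 1) : ℝ) - (eventTime c l : ℝ)

/-- The set of jump times of the counting path `c`. -/
def jumpTimes (c : ℝ≥0 → ℕ) : Set ℝ≥0 := {a | 0 < a ∧ ∀ s < a, c s < c a}

/-- The `k`-th smallest (with multiplicity) of the numbers `Y i`, `i ∈ s`, for `1 ≤ k ≤ |s|`. -/
def orderStat {ι : Type*} (s : Set ι) (k : ℕ) (Y : ι → ℝ) : ℝ :=
  sInf {x : ℝ | k ≤ {i ∈ s | Y i ≤ x}.ncard}

/-! The communication network is a digraph on `Option V`: `none` is the source (node `0`), and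
`some i`, `i : V`, are the receiver nodes. -/

/-- The receiver nodes with an edge towards the receiver node `j`. -/
def inNeighbors {V : Type*} (G : Digraph (Option V)) (j : V) : Set V :=
  {i | G.Adj (some i) (some j)}

/-- The network has no self-loops, the source has an edge to every receiver node, and the in-degree
of every receiver node (counted in the whole digraph, source included) is greater than `k`. -/
structure IsTSSFeasible {V : Type*} (G : Digraph (Option V)) (k : ℕ) : Prop where
  loopless : ∀ v, ¬ G.Adj v v
  source_adj : ∀ j : V, G.Adj none (some j)
  lt_inDegree : ∀ j : V, k < {v | G.Adj v (some j)}.ncard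

/-- The edges between receiver nodes. -/
abbrev Edge {V : Type*} (G : Digraph (Option V)) : Type _ :=
  {e : V × V // G.Adj (some e.1) (some e.2)}

/-- The counting path of the source (index `none`) and of the edges (index `some e`). -/
def counterPath {V Ω : Type*} {G : Digraph (Option V)} (N₀ : ℝ≥0 → Ω → ℕ)
    (N : V → V → ℝ≥0 → Ω → ℕ) : Option (Edge G) → Ω → ℝ≥0 → ℕ
  | none, ω, t => N₀ t ω
  | some e, ω, t => N e.1.1 e.1.2 t ω

/-- `N₀` counts the updates at the source, a Poisson counter of rate `lamS`; `N i j` counts the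
activations of the edge from `i` to `j`, a Poisson counter of rate `lamE i j`; all these counters
are independent processes. (`N i j` and `lamE i j` play no role if there is no such edge.) -/
structure IsGossipProcess {V Ω : Type*} [MeasurableSpace Ω] (G : Digraph (Option V))
    (lamS : ℝ≥0) (lamE : V → V → ℝ≥0) (N₀ : ℝ≥0 → Ω → ℕ) (N : V → V → ℝ≥0 → Ω → ℕ)
    (P : Measure Ω) : Prop where
  source : IsPoissonCounter N₀ lamS P
  edge : ∀ i j, G.Adj (some i) (some j) → IsPoissonCounter (N i j) (lamE i j) P
  indep : iIndepFun (counterPath (G := G) N₀ N) P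

section Path

/-! Fixed realisations: `c₀` is the path of the source counter, `c i j` that of the edge from `i`
to `j`. Full subscription: for each version `l` the source makes `n` keys and at the time of the
`l`-th update it sends the key `keyOf l i` to the receiver node `i`, each node getting a key of its
own; so `keyOf l : V ≃ Fin n`. Version `l` has been generated by time `t` iff `l ≤ c₀ t`. -/

variable {V : Type*}

/-- The versions whose keys are sent, in the memory scheme, over an edge with counting path `c` when
it is activated at time `a`: those generated up to time `a`, and later than every earlier activation
of this edge. -/
def sentVersions (c₀ c : ℝ≥0 → ℕ) (a : ℝ≥0) : Set ℕ :=
  {l | l ≤ c₀ a ∧ ∀ a' ∈ jumpTimes c, a' < a → c₀ a' < l}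

/-- The keys of version `l` that node `j` holds at time `t`: the one received from the source, and
those sent to it by its in-neighbors, which pass on only what they got from the source. -/
def heldKeys (G : Digraph (Option V)) {n : ℕ} (keyOf : ℕ → V ≃ Fin n) (c₀ : ℝ≥0 → ℕ)
    (c : V → V → ℝ≥0 → ℕ) (j : V) (l : ℕ) (t : ℝ≥0) : Set (Fin n) :=
  {x | (x = keyOf l j ∧ l ≤ c₀ t) ∨
    ∃ i ∈ inNeighbors G j, x = keyOf l i ∧
      ∃ a ∈ jumpTimes (c i j), a ≤ t ∧ l ∈ sentVersions c₀ (c i j) a}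

/-- The latest version that node `j` can decode at time `t`, that is, for which it holds at least
`k + 1` keys; it is `0` (the initial version) if there is none. -/
def latestDecoded (G : Digraph (Option V)) (k : ℕ) {n : ℕ} (keyOf : ℕ → V ≃ Fin n)
    (c₀ : ℝ≥0 → ℕ) (c : V → V → ℝ≥0 → ℕ) (j : V) (t : ℝ≥0) : ℕ :=
  sSup {l | k + 1 ≤ (heldKeys G keyOf c₀ c j l t).ncard}

/-- The `k`-keys version age of node `j` at time `t`. -/
def versionAge (G : Digraph (Option V)) (k : ℕ) {n : ℕ} (keyOf : ℕ → V ≃ Fin n)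
    (c₀ : ℝ≥0 → ℕ) (c : V → V → ℝ≥0 → ℕ) (j : V) (t : ℝ≥0) : ℝ :=
  (c₀ t : ℝ) - (latestDecoded G k keyOf c₀ c j t : ℝ)

end Path

end GossipAge

end

/-! An update stays undecoded at node `j` exactly until `k` in-edges of `j` have been activated
after it: the source supplies one key, each activated in-edge supplies another one (memory makes it
pass on every version not yet sent), and these keys are distinct. So the age at time `t` is the
number of updates at times `u ≤ t` such that fewer than `k` in-edges are activated in `(u, t]`. The
activation counts are Poisson, so this event has the probability that the `k`-th smallest of
independent exponential waiting times exceeds `t - u`. Hence the mean age tends to `lamS` times the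
integral of the tail of the order statistic, that is, to `lamS * E[𝒳] = E[𝒳] / E[U]`.

To pass from means to almost sure time averages, time is cut into cells of length `1 / q`. Rounding
the pending condition in the two possible directions gives the step functions `pendingOn` with `d =
0` and `d = 1`, which enclose the age up to the updates of the current cell (`le_versionAge`,
`versionAge_le`). Updates pending at cell `p` influence cell `p' > p` only if fewer than `k`
in-edges are activated in between, which is exponentially unlikely. So covariances decay
geometrically (`integral_pendingOn_mul_le`), and a law of large numbers applies
(`ae_tendsto_average_of_covariance_le`).

The counters are given by their increments, so the exponential law of an arbitrary interarrival time
is proved (`measureReal_lt_interarrival`) and then transferred to order statistics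
(`measureReal_ncard_interarrival`). Both bounding averages lie within `2 * lamS / q` of the limit
(`ae_exists_grid_bounds`), and `tendsto_average_integral_of_grid` lets `q` grow. -/

namespace GossipAge

/-! ### A law of large numbers under decaying covariances -/

section LargeNumbers

variable {Ω : Type*} [MeasurableSpace Ω] {P : Measure Ω}

/-- Nonnegative random variables with summable means tend to `0` almost surely. -/
lemma ae_tendsto_zero_of_integral_le {f : ℕ → Ω → ℝ} (hf : ∀ m, Integrable (f m) P)
    (hnn : ∀ m ω, 0 ≤ f m ω) {a : ℕ → ℝ} (ha : Summable a) (hle : ∀ m, ∫ ω, f m ω ∂P ≤ a m) :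
    ∀ᵐ ω ∂P, Tendsto (fun m => f m ω) atTop (𝓝 0) := by
  have ha0 : ∀ m, 0 ≤ a m := fun m => (integral_nonneg (hnn m)).trans (hle m)
  have h1 : ∫⁻ ω, ∑' m, ENNReal.ofReal (f m ω) ∂P ≠ ⊤ := by
    rw [lintegral_tsum fun m => (hf m).aemeasurable.ennreal_ofReal]
    refine ne_top_of_le_ne_top ha.tsum_ofReal_ne_top (ENNReal.tsum_le_tsum fun m => ?_)
    rw [← ofReal_integral_eq_lintegral_ofReal (hf m) (ae_of_all _ (hnn m))]
    exact ENNReal.ofReal_le_ofReal (hle m)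
  have h2 := ae_lt_top' (AEMeasurable.tsum fun m => (hf m).aemeasurable.ennreal_ofReal) h1
  filter_upwards [h2] with ω hω
  have h3 := ENNReal.tendsto_atTop_zero_of_tsum_ne_top hω.ne
  have h4 := (ENNReal.tendsto_toReal ENNReal.zero_ne_top).comp h3
  simpa [Function.comp_def, ENNReal.toReal_ofReal (hnn _ ω)] using h4

/-- The exponent is the distance of `p` and `q`, so each row is bounded by two geometric series, one
on each side of the diagonal. This makes the variance of a sum of `n` terms linear in `n`. -/
lemma sum_geom_dist_le {r : ℝ} (hr0 : 0 ≤ r) (hr1 : r < 1) (n : ℕ) :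
    ∑ p ∈ Finset.range n, ∑ q ∈ Finset.range n, r ^ (max p q - min p q) ≤ n * (2 / (1 - r)) := by
  have key : ∀ p ∈ Finset.range n,
      ∑ q ∈ Finset.range n, r ^ (max p q - min p q) ≤ 2 / (1 - r) := by
    intro p hp
    have hgeo : ∀ m, ∑ i ∈ Finset.range m, r ^ i ≤ 1 / (1 - r) := fun m => by
      simpa using (summable_geometric_of_lt_one hr0 hr1).sum_le_tsum (Finset.range m)
        (fun i _ => pow_nonneg hr0 i) |>.trans_eq (tsum_geometric_of_lt_one hr0 hr1)
    have hp' : p ≤ n := (Finset.mem_range.1 hp).le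
    have h1 : ∑ q ∈ Finset.range p, r ^ (max p q - min p q) ≤ 1 / (1 - r) := by
      rw [← Finset.sum_range_reflect]
      calc _ ≤ ∑ i ∈ Finset.range p, r ^ i := Finset.sum_le_sum fun i hi => by
            have := Finset.mem_range.1 hi
            apply pow_le_pow_of_le_one hr0 hr1.le
            omega
        _ ≤ _ := hgeo p
    have h2 : ∑ q ∈ Finset.range (n - p), r ^ (max p (p + q) - min p (p + q)) ≤ 1 / (1 - r) := by
      refine le_trans (Finset.sum_le_sum fun i _ => ?_) (hgeo (n - p))
      simp
    rw [← Nat.add_sub_cancel' hp', Finset.sum_range_add]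
    have h3 : 2 / (1 - r) = 1 / (1 - r) + 1 / (1 - r) := by ring
    linarith
  calc _ ≤ ∑ p ∈ Finset.range n, 2 / (1 - r) := Finset.sum_le_sum key
    _ = _ := by simp

/-- A strong law of large numbers for nonnegative random variables with convergent means and
geometrically decaying covariances. -/
theorem ae_tendsto_average_of_covariance_le [IsProbabilityMeasure P] {Y : ℕ → Ω → ℝ}
    (hY : ∀ p, MemLp (Y p) 2 P) (hnn : ∀ p ω, 0 ≤ Y p ω) {C r : ℝ} (hC : 0 ≤ C) (hr0 : 0 ≤ r)
    (hr1 : r < 1)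
    (hcov : ∀ p q, p ≤ q →
      ∫ ω, Y p ω * Y q ω ∂P ≤ (∫ ω, Y p ω ∂P) * (∫ ω, Y q ω ∂P) + C * r ^ (q - p))
    {μ : ℝ} (hμ : Tendsto (fun p => ∫ ω, Y p ω ∂P) atTop (𝓝 μ)) :
    ∀ᵐ ω ∂P, Tendsto (fun n : ℕ => (∑ p ∈ Finset.range n, Y p ω) / n) atTop (𝓝 μ) := by
  have hint : ∀ p, Integrable (Y p) P := fun p => (hY p).integrable one_le_two
  set S : ℕ → Ω → ℝ := fun n ω => ∑ p ∈ Finset.range n, Y p ω with hS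
  have hSm : ∀ n, MemLp (S n) 2 P := fun n => memLp_finsetSum _ fun p _ => hY p
  have hES : ∀ n, ∫ ω, S n ω ∂P = ∑ p ∈ Finset.range n, ∫ ω, Y p ω ∂P := fun n =>
    integral_finsetSum _ fun p _ => hint p
  have hcov' : ∀ p q, cov[Y p, Y q; P] ≤ C * r ^ (max p q - min p q) := by
    intro p q
    rcases le_total p q with h | h
    · rw [covariance_eq_sub (hY p) (hY q), max_eq_right h, min_eq_left h]
      have := hcov p q h
      simp only [Pi.mul_apply]
      linarith
    · rw [covariance_comm, covariance_eq_sub (hY q) (hY p), max_eq_left h, min_eq_right h]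
      have := hcov q p h
      simp only [Pi.mul_apply]
      linarith
  have hvar : ∀ n, Var[S n; P] ≤ n * (C * (2 / (1 - r))) := by
    intro n
    rw [hS, variance_fun_sum' fun p _ => hY p]
    calc _ ≤ ∑ p ∈ Finset.range n, ∑ q ∈ Finset.range n, C * r ^ (max p q - min p q) :=
          Finset.sum_le_sum fun p _ => Finset.sum_le_sum fun q _ => hcov' p q
      _ = C * ∑ p ∈ Finset.range n, ∑ q ∈ Finset.range n, r ^ (max p q - min p q) := by
          simp [Finset.mul_sum]
      _ ≤ C * (n * (2 / (1 - r))) := mul_le_mul_of_nonneg_left (sum_geom_dist_le hr0 hr1 n) hC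
      _ = _ := by ring
  -- Along the squares `(m + 1) ^ 2` the variance of the average is of order `1 / (m + 1) ^ 2`,
  -- hence summable; this gives almost sure convergence on that subsequence.
  set f : ℕ → Ω → ℝ := fun m ω =>
    ((S ((m + 1) ^ 2) ω - ∫ ω', S ((m + 1) ^ 2) ω' ∂P) / ((m + 1 : ℕ) ^ 2 : ℕ)) ^ 2 with hf
  have hfi : ∀ m, Integrable (f m) P := fun m => by
    have := ((hSm ((m + 1) ^ 2)).sub (memLp_const (∫ ω', S ((m + 1) ^ 2) ω' ∂P))).integrable_sq
    simp only [hf, div_pow]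
    exact this.div_const _
  have hfle : ∀ m, ∫ ω, f m ω ∂P ≤ C * (2 / (1 - r)) * (1 / ((m + 1 : ℕ) : ℝ) ^ 2) := by
    intro m
    have h := hvar ((m + 1) ^ 2)
    rw [variance_eq_integral (hSm _).aemeasurable] at h
    simp only [hf, div_pow]
    rw [integral_div]
    have hpos : (0 : ℝ) < ((m + 1 : ℕ) : ℝ) := by positivity
    rw [div_le_iff₀ (by positivity)]
    refine h.trans_eq ?_
    push_cast
    push_cast at hpos
    field_simp
  have hsum : Summable fun m : ℕ => C * (2 / (1 - r)) * (1 / ((m + 1 : ℕ) : ℝ) ^ 2) :=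
    ((summable_nat_add_iff 1).2 (Real.summable_one_div_nat_pow.2 one_lt_two)).mul_left _
  filter_upwards [ae_tendsto_zero_of_integral_le hfi (fun m ω => sq_nonneg _) hsum hfle] with ω hω
  have hc : Tendsto (fun m : ℕ => (m + 1) ^ 2) atTop atTop :=
    (tendsto_pow_atTop two_ne_zero).comp (tendsto_add_atTop_nat 1)
  have hmean : Tendsto (fun n : ℕ => (∫ ω', S n ω' ∂P) / n) atTop (𝓝 μ) := by
    refine hμ.cesaro.congr fun n => ?_
    rw [hES]
    field_simp
  have hdiff : Tendsto (fun m : ℕ =>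
      (S ((m + 1) ^ 2) ω - ∫ ω', S ((m + 1) ^ 2) ω' ∂P) / ((m + 1 : ℕ) ^ 2 : ℕ)) atTop (𝓝 0) := by
    have := (Real.continuous_sqrt.tendsto 0).comp hω
    simp only [hf, Function.comp_def, Real.sqrt_sq_eq_abs, Real.sqrt_zero] at this
    exact tendsto_zero_iff_abs_tendsto_zero _ |>.2 this
  -- Nonnegativity makes the partial sums monotone, and the ratio of consecutive squares tends to
  -- `1`, so the gaps between squares are harmless.
  refine tendsto_div_of_monotone_of_exists_subseq_tendsto_div (fun n => S n ω) μ ?_ ?_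
  · refine monotone_nat_of_le_succ fun n => ?_
    simp only [hS, Finset.sum_range_succ]
    linarith [hnn n ω]
  · intro a ha
    refine ⟨fun m => (m + 1) ^ 2, ?_, hc, ?_⟩
    · have h1 : Tendsto (fun m : ℕ => (1 + 1 / ((m : ℝ) + 1)) ^ 2) atTop (𝓝 ((1 + 0) ^ 2)) :=
        (tendsto_const_nhds.add tendsto_one_div_add_atTop_nhds_zero_nat).pow 2
      have h2 := h1.eventually_le_const (by simpa using ha)
      filter_upwards [h2] with m hm
      have h3 := mul_le_mul_of_nonneg_right hm (sq_nonneg ((m : ℝ) + 1))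
      push_cast
      refine le_trans (le_of_eq ?_) h3
      field_simp
    · have := hdiff.add (hmean.comp hc)
      rw [zero_add] at this
      refine this.congr fun m => ?_
      simp only [Function.comp_def]
      ring

end LargeNumbers

/-! ### First and second moments of the Poisson law -/

section PoissonMoments

lemma memLp_natCast_poissonMeasure (a : ℝ≥0) :
    MemLp (fun n : ℕ => (n : ℝ)) 2 (poissonMeasure a) := by
  rw [memLp_two_iff_integrable_sq_norm (by fun_prop), integrable_poissonMeasure_iff]
  refine Summable.of_nonneg_of_le (fun n => by positivity) (fun n => ?_)
    (Real.summable_pow_div_factorial (4 * a))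
  -- This bounds the second moment series by the exponential series at `4 * a`.
  have h1 : (n : ℝ) ^ 2 ≤ 4 ^ n := by
    have : (n : ℝ) ≤ 2 ^ n := by exact_mod_cast Nat.lt_two_pow_self.le
    calc (n : ℝ) ^ 2 ≤ (2 ^ n) ^ 2 := by gcongr
      _ = 4 ^ n := by rw [← pow_mul, mul_comm, pow_mul]; norm_num
  have h2 : Real.exp (-(a : ℝ)) ≤ 1 := Real.exp_le_one_iff.2 (by simp)
  simp only [norm_pow, Real.norm_natCast]
  rw [mul_pow]
  calc _ ≤ 1 * (a : ℝ) ^ n / n.factorial * (4 : ℝ) ^ n := by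
        gcongr
    _ = _ := by ring

lemma integral_natCast_poissonMeasure (a : ℝ≥0) :
    ∫ n : ℕ, (n : ℝ) ∂(poissonMeasure a) = a := by
  have h := hasSum_integral_poissonMeasure
    ((memLp_natCast_poissonMeasure a).integrable one_le_two)
  -- The term at `0` vanishes, and after the shift the factor `n + 1` cancels against the factorial,
  -- leaving `a` times the Poisson weights.
  rw [← hasSum_nat_add_iff' 1] at h
  simp only [Finset.range_one, Finset.sum_singleton, CharP.cast_eq_zero, smul_zero, sub_zero] at h
  refine h.unique ?_
  convert! (hasSum_one_poissonMeasure a).mul_right (a : ℝ) using 2 with n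
  · rw [Nat.factorial_succ, pow_succ]
    push_cast
    have : ((n : ℝ) + 1) ≠ 0 := by positivity
    simp only [smul_eq_mul]
    field_simp
  · simp

end PoissonMoments

/-! ### Event times of a counting path -/

section CountingPath

/-- A nondecreasing, right-continuous, unbounded counting path. -/
structure IsRegularPath (c : ℝ≥0 → ℕ) : Prop where
  mono : Monotone c
  rightCts : ∀ t, ContinuousWithinAt c (Set.Ici t) t
  unbounded : ∀ l, ∃ t, l ≤ c t

lemma exists_gt_eq_of_rightCts {c : ℝ≥0 → ℕ} {t : ℝ≥0}
    (h : ContinuousWithinAt c (Set.Ici t) t) : ∃ b > t, c b = c t := by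
  have h1 : ∀ᶠ s in 𝓝[≥] t, c s = c t :=
    h.eventually (p := (· = c t)) (by rw [nhds_discrete]; simp)
  have h2 : ∀ᶠ s in 𝓝[>] t, c s = c t := h1.filter_mono (nhdsWithin_mono _ Set.Ioi_subset_Ici_self)
  obtain ⟨b, hb, hbt⟩ := (h2.and self_mem_nhdsWithin).exists
  exact ⟨b, hbt, hb⟩

/-- Right-continuity with integer values makes the path constant just after each time, so the
infimum defining the event time is attained. -/
lemma IsRegularPath.eventTime_le_iff {c : ℝ≥0 → ℕ} (hc : IsRegularPath c) {l : ℕ} {t : ℝ≥0} :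
    eventTime c l ≤ t ↔ l ≤ c t := by
  refine ⟨fun h => ?_, fun h => csInf_le (OrderBot.bddBelow _) h⟩
  have hmem : l ≤ c (eventTime c l) := by
    obtain ⟨b, hb, hbc⟩ := exists_gt_eq_of_rightCts (hc.rightCts (eventTime c l))
    obtain ⟨s, hs, hsb⟩ := exists_lt_of_csInf_lt (hc.unbounded l) hb
    rw [← hbc]
    exact le_trans hs (hc.mono hsb.le)
  exact hmem.trans (hc.mono h)

/-- A version of `eventTime` that is measurable with respect to the path. -/
noncomputable def countableEventTime (l : ℕ) (c : ℝ≥0 → ℕ) : ℝ :=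
  (⨅ m : ℕ, if l ≤ c (TopologicalSpace.denseSeq ℝ≥0 m)
    then (TopologicalSpace.denseSeq ℝ≥0 m : ENNReal) else ⊤).toReal

lemma measurable_countableEventTime (l : ℕ) : Measurable (countableEventTime l) := by
  refine ENNReal.measurable_toReal.comp (Measurable.iInf fun m => ?_)
  exact Measurable.ite (measurableSet_le measurable_const (measurable_pi_apply _))
    measurable_const measurable_const

lemma IsRegularPath.eventTime_eq {c : ℝ≥0 → ℕ} (hc : IsRegularPath c) (l : ℕ) :
    (eventTime c l : ℝ) = countableEventTime l c := by
  have : (eventTime c l : ENNReal) = ⨅ m : ℕ, if l ≤ c (TopologicalSpace.denseSeq ℝ≥0 m)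
      then (TopologicalSpace.denseSeq ℝ≥0 m : ENNReal) else ⊤ := by
    refine le_antisymm (le_iInf fun m => ?_) ?_
    · split_ifs with h
      · exact_mod_cast hc.eventTime_le_iff.2 h
      · exact le_top
    · refine ENNReal.le_of_forall_pos_le_add fun ε hε _ => ?_
      obtain ⟨_, ⟨m, rfl⟩, hm1, hm2⟩ := (TopologicalSpace.denseRange_denseSeq ℝ≥0).exists_between
        (lt_add_of_pos_right (eventTime c l) hε)
      refine (iInf_le _ m).trans ?_
      rw [if_pos (hc.eventTime_le_iff.1 hm1.le)]
      exact_mod_cast hm2.le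
  rw [countableEventTime, ← this]
  simp

lemma IsRegularPath.interarrival_nonneg {c : ℝ≥0 → ℕ} (hc : IsRegularPath c) (l : ℕ) :
    0 ≤ interarrival c l := by
  have : eventTime c l ≤ eventTime c (l + 1) :=
    hc.eventTime_le_iff.2 ((Nat.le_succ l).trans (hc.eventTime_le_iff.1 le_rfl))
  exact sub_nonneg.2 (by exact_mod_cast this)

lemma IsRegularPath.interarrival_eq {c : ℝ≥0 → ℕ} (hc : IsRegularPath c) (l : ℕ) :
    interarrival c l = countableEventTime (l + 1) c - countableEventTime l c := by
  rw [interarrival, hc.eventTime_eq, hc.eventTime_eq]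

end CountingPath

/-! ### Poisson counters have exponential interarrival times -/

namespace IsPoissonCounter

variable {Ω : Type*} [MeasurableSpace Ω] {P : Measure Ω} {N : ℝ≥0 → Ω → ℕ} {r : ℝ≥0}

lemma hasLaw (hN : IsPoissonCounter N r P) (t : ℝ≥0) : HasLaw (N t) (poissonMeasure (r * t)) P := by
  have := hN.increment_law 0 t bot_le
  rw [tsub_zero] at this
  refine this.congr ?_
  filter_upwards [hN.path_zero] with ω hω
  simp [hω]

lemma measure_lt (hN : IsPoissonCounter N r P) (t : ℝ≥0) (l : ℕ) :
    P {ω | N t ω < l} = ∑ m ∈ Finset.range l,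
      ENNReal.ofReal (Real.exp (-(r * t : ℝ≥0)) * (r * t : ℝ≥0) ^ m / m.factorial) := by
  rw [(hN.hasLaw t).measure_eq (p := fun n => n < l) (MeasurableSet.of_discrete)]
  have : {x : ℕ | x < l} = (Finset.range l : Set ℕ) := by ext; simp
  rw [this, ← sum_measure_singleton]
  simp only [poissonMeasure_singleton]

/-- As a function of `t`, the Poisson weight at `m` is `1 / r` times the Gamma density of shape `m +
1`, so each of the `l` terms integrates to `1 / r`. -/
lemma lintegral_measure_lt (hN : IsPoissonCounter N r P) (hr : 0 < r) (l : ℕ) :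
    ∫⁻ t in Set.Ioi (0 : ℝ), P {ω | N t.toNNReal ω < l} = ENNReal.ofReal (l / r) := by
  have hr' : (0 : ℝ) < r := hr
  have key : ∀ m : ℕ, ∫⁻ t in Set.Ioi (0 : ℝ), ENNReal.ofReal
      (Real.exp (-(r * t.toNNReal : ℝ≥0)) * (r * t.toNNReal : ℝ≥0) ^ m / m.factorial)
      = ENNReal.ofReal (1 / r) := by
    intro m
    have h1 := lintegral_gammaPDF_eq_one (a := m + 1) (r := r) (by positivity) hr'
    have h2 : ∫⁻ t in Set.Ioi (0 : ℝ), gammaPDF (m + 1) r t = 1 := by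
      have h3 : ∫⁻ t in Set.Iic (0 : ℝ), gammaPDF (m + 1) r t = 0 := by
        rw [← setLIntegral_congr Iio_ae_eq_Iic, lintegral_gammaPDF_of_nonpos le_rfl]
      rw [← h1, ← lintegral_add_compl (μ := volume) _ (measurableSet_Ioi (a := (0 : ℝ))),
        Set.compl_Ioi, h3, add_zero]
    calc _ = ∫⁻ t in Set.Ioi (0 : ℝ), ENNReal.ofReal (1 / r) * gammaPDF (m + 1) r t := by
          refine setLIntegral_congr_fun measurableSet_Ioi fun t ht => ?_
          have ht' : (0 : ℝ) < t := ht
          rw [gammaPDF_of_nonneg ht'.le, ← ENNReal.ofReal_mul (by positivity)]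
          congr 1
          rw [Real.Gamma_nat_eq_factorial, NNReal.coe_mul, Real.coe_toNNReal _ ht'.le,
            add_sub_cancel_right, Real.rpow_natCast]
          rw [show ((m : ℝ) + 1) = ((m + 1 : ℕ) : ℝ) by push_cast; ring, Real.rpow_natCast]
          rw [mul_pow, pow_succ]
          field_simp
      _ = _ := by
          have h4 : Measurable (gammaPDF (m + 1) r) := (measurable_gammaPDFReal _ _).ennreal_ofReal
          rw [lintegral_const_mul _ h4, h2, mul_one]
  simp only [hN.measure_lt]
  rw [lintegral_finsetSum']
  · simp only [key]
    rw [Finset.sum_const, Finset.card_range, nsmul_eq_mul, ← ENNReal.ofReal_natCast,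
      ← ENNReal.ofReal_mul (by positivity), mul_one_div]
  · intro m _
    fun_prop

/-- A positive probability of never reaching `l` would bound `P (N t < l)` below for all `t`,
contradicting the finite integral just computed. -/
lemma ae_unbounded (hN : IsPoissonCounter N r P) (hr : 0 < r) : ∀ᵐ ω ∂P, ∀ l, ∃ t, l ≤ N t ω := by
  rw [ae_all_iff]
  intro l
  have h := hN.lintegral_measure_lt hr l
  set p := P {ω | ¬ ∃ t, l ≤ N t ω} with hp
  have h1 : ∫⁻ _ in Set.Ioi (0 : ℝ), p ≤ ENNReal.ofReal (l / r) := by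
    rw [← h]
    refine lintegral_mono fun t => measure_mono fun ω hω => ?_
    simp only [Set.mem_ofPred_eq, not_exists, not_le] at hω ⊢
    exact hω _
  rw [setLIntegral_const, Real.volume_Ioi] at h1
  change p = 0
  by_contra h0
  rw [ENNReal.mul_top h0] at h1
  exact absurd h1 (by simp)

lemma ae_isRegularPath (hN : IsPoissonCounter N r P) (hr : 0 < r) :
    ∀ᵐ ω ∂P, IsRegularPath fun t => N t ω := by
  filter_upwards [hN.path_mono, hN.path_rightCts, hN.ae_unbounded hr] with ω h1 h2 h3
  exact ⟨h1, h2, h3⟩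

lemma measurable_path (hN : IsPoissonCounter N r P) : Measurable fun ω t => N t ω :=
  measurable_pi_lambda _ hN.measurable

lemma aemeasurable_eventTime (hN : IsPoissonCounter N r P) (hr : 0 < r) (l : ℕ) :
    AEMeasurable (fun ω => (eventTime (fun t => N t ω) l : ℝ)) P := by
  refine ⟨_, (measurable_countableEventTime l).comp hN.measurable_path, ?_⟩
  filter_upwards [hN.ae_isRegularPath hr] with ω hω
  exact hω.eventTime_eq l

lemma lintegral_eventTime (hN : IsPoissonCounter N r P) (hr : 0 < r) (l : ℕ) :
    ∫⁻ ω, ENNReal.ofReal (eventTime (fun t => N t ω) l) ∂P = ENNReal.ofReal (l / r) := by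
  rw [lintegral_eq_lintegral_meas_lt P (ae_of_all _ fun ω => NNReal.coe_nonneg _)
    (hN.aemeasurable_eventTime hr l), ← hN.lintegral_measure_lt hr l]
  refine setLIntegral_congr_fun measurableSet_Ioi fun t ht => measure_congr ?_
  filter_upwards [hN.ae_isRegularPath hr] with ω hω
  have := (hω.eventTime_le_iff (l := l) (t := t.toNNReal)).not
  rw [not_le, not_le] at this
  simp only [eq_iff_iff]
  change t < _ ↔ N t.toNNReal ω < l
  rw [← this, Real.toNNReal_lt_iff_lt_coe (le_of_lt ht)]

lemma integrable_eventTime (hN : IsPoissonCounter N r P) (hr : 0 < r) (l : ℕ) :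
    Integrable (fun ω => (eventTime (fun t => N t ω) l : ℝ)) P := by
  refine ⟨(hN.aemeasurable_eventTime hr l).aestronglyMeasurable, ?_⟩
  rw [hasFiniteIntegral_iff_ofReal (ae_of_all _ fun ω => NNReal.coe_nonneg _),
    hN.lintegral_eventTime hr]
  exact ENNReal.ofReal_lt_top

lemma integral_eventTime (hN : IsPoissonCounter N r P) (hr : 0 < r) (l : ℕ) :
    ∫ ω, (eventTime (fun t => N t ω) l : ℝ) ∂P = l / r := by
  rw [integral_eq_lintegral_of_nonneg_ae (ae_of_all _ fun ω => NNReal.coe_nonneg _)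
    (hN.aemeasurable_eventTime hr l).aestronglyMeasurable, hN.lintegral_eventTime hr,
    ENNReal.toReal_ofReal (by positivity)]

/-- Split according to the cell of mesh `h` containing the `l`-th event. A gap longer than `x + h`
forces no event in the window of length `x` right after that cell; this window is independent of the
past, and the cells are disjoint events. The loss of `h` disappears in the limit. -/
lemma measure_interarrival_add_le [IsProbabilityMeasure P] (hN : IsPoissonCounter N r P)
    (hr : 0 < r) (l : ℕ) (x h : ℝ≥0) (hh : 0 < h) :
    P {ω | (x + h : ℝ) < interarrival (fun t => N t ω) l} ≤
      ENNReal.ofReal (Real.exp (-(r * x))) := by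
  -- The breakpoints `0`, `u * h`, `(u + 1) * h`, `(u + 1) * h + x` as a monotone sequence, so that
  -- independence of increments applies.
  set g : ℕ → ℕ → ℝ≥0 := fun u m => if m = 0 then 0 else if m = 1 then u * h else
    if m = 2 then (u + 1) * h else (u + 1) * h + x with hg
  have hgm : ∀ u, Monotone (g u) := by
    intro u
    refine monotone_nat_of_le_succ fun m => ?_
    have h1 : (u : ℝ≥0) * h ≤ (u + 1) * h := by gcongr; simp
    rcases m with _ | _ | _ | m <;> simp [hg, h1]
  set D : ℕ → ℕ → Ω → ℕ := fun u i ω => N (g u (i + 1)) ω - N (g u i) ω with hD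
  have hDm : ∀ u i, Measurable (D u i) := fun u i => (hN.measurable _).sub (hN.measurable _)
  -- The `l`-th event falls in cell `u`. The alternative `u = 0` covers `l = 0`, whose event time
  -- `0` lies in no half-open cell `(u * h, (u + 1) * h]`.
  set C : ℕ → Set Ω := fun u =>
    {ω | (N (u * h) ω < l ∨ u = 0) ∧ l ≤ N ((u + 1) * h) ω} with hC
  set B : ℕ → Set (ℕ × ℕ) := fun u => {y | (y.1 < l ∨ u = 0) ∧ l ≤ y.1 + y.2} with hB
  have hCm : ∀ u, MeasurableSet (C u) := fun u => by
    refine MeasurableSet.inter (MeasurableSet.union ?_ (MeasurableSet.const _)) ?_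
    · exact measurableSet_lt (hN.measurable _) measurable_const
    · exact measurableSet_le measurable_const (hN.measurable _)
  have hCB : ∀ u, C u =ᵐ[P] (fun ω => (D u 0 ω, D u 1 ω)) ⁻¹' B u := by
    intro u
    filter_upwards [hN.path_zero, hN.path_mono] with ω h0 hm
    have h1 : N (u * h) ω ≤ N ((u + 1) * h) ω := hm (by gcongr; simp)
    have h2 : D u 0 ω = N (u * h) ω := by simp [hD, hg, h0]
    have h3 : D u 1 ω = N ((u + 1) * h) ω - N (u * h) ω := by simp [hD, hg]
    change (_ ∧ _) = (_ ∧ _)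
    simp only [h2, h3, Nat.add_sub_cancel' h1]
  have hprod : ∀ u, P (C u ∩ {ω | D u 2 ω = 0}) = P (C u) * ENNReal.ofReal (Real.exp (-(r * x))) := by
    intro u
    have hind := (hN.indep_increments.nat (hgm u)).indepFun_prodMk (hDm u) 0 1 2 (by simp) (by simp)
    have h1 := hind.measure_inter_preimage_eq_mul (B u) {0} .of_discrete .of_discrete
    have h2 : P {ω | D u 2 ω = 0} = ENNReal.ofReal (Real.exp (-(r * x))) := by
      have := (hN.increment_law ((u + 1) * h) ((u + 1) * h + x) le_self_add).measure_eq
        (p := fun n => n = 0) .of_discrete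
      rw [add_tsub_cancel_left] at this
      simp only [hD, hg]
      simp only [Nat.reduceAdd, OfNat.ofNat_ne_zero, if_false, if_true, Nat.reduceEqDiff,
        OfNat.ofNat_ne_one]
      rw [this]
      have h3 : {n : ℕ | n = 0} = {0} := rfl
      rw [h3, poissonMeasure_singleton]
      simp
    have h4 : (C u ∩ {ω | D u 2 ω = 0} : Set Ω) =ᵐ[P]
      ((fun ω => (D u 0 ω, D u 1 ω)) ⁻¹' B u ∩ {ω | D u 2 ω = 0} : Set Ω) :=
      (hCB u).inter (ae_eq_refl _)
    rw [measure_congr h4, measure_congr (hCB u), ← h2]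
    exact h1
  have hdisj : Pairwise (Function.onFun (AEDisjoint P) C) := by
    have key : ∀ u v, u < v → AEDisjoint P (C u) (C v) := by
      intro u v huv
      refine measure_eq_zero_iff_ae_notMem.2 ?_
      filter_upwards [hN.path_mono] with ω hm
      rintro ⟨⟨-, h1⟩, ⟨h2 | h2, -⟩⟩
      · have h3 : ((u : ℝ≥0) + 1) * h ≤ v * h := by
          gcongr
          exact_mod_cast huv
        exact absurd (h1.trans (hm h3)) (not_le.2 h2)
      · omega
    intro u v huv
    rcases huv.lt_or_gt with h | h
    · exact key u v h
    · exact (key v u h).symm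
  calc _ ≤ P (⋃ u, C u ∩ {ω | D u 2 ω = 0}) := by
        refine measure_mono_ae ?_
        filter_upwards [hN.ae_isRegularPath hr] with ω hω
        intro hx
        change (x + h : ℝ) < interarrival (fun t => N t ω) l at hx
        have hex : ∃ u : ℕ, l ≤ N ((u + 1) * h) ω := by
          obtain ⟨t, ht⟩ := hω.unbounded l
          obtain ⟨u, hu⟩ := exists_nat_ge (t / h)
          refine ⟨u, ht.trans (hω.mono ?_)⟩
          rw [div_le_iff₀ hh] at hu
          exact hu.trans (by gcongr; simp)
        have hu := Nat.find_spec hex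
        have hmin : N ((Nat.find hex : ℕ) * h) ω < l ∨ Nat.find hex = 0 := by
          rcases Nat.eq_zero_or_pos (Nat.find hex) with h0 | h0
          · exact Or.inr h0
          · left
            have := Nat.find_min hex (m := Nat.find hex - 1) (by omega)
            rw [not_le] at this
            convert! this using 3
            have h1 : ((Nat.find hex - 1 + 1 : ℕ) : ℝ≥0) = (Nat.find hex : ℕ) := by
              congr 1
              omega
            rw [← h1]
            push_cast
            rfl
        set u := Nat.find hex
        refine Set.mem_iUnion.2 ⟨u, ⟨hmin, hu⟩, ?_⟩
        have h1 : (u : ℝ≥0) * h ≤ eventTime (fun t => N t ω) l := by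
          rcases hmin with h0 | h0
          · by_contra hlt
            exact absurd (hω.eventTime_le_iff.1 (not_le.1 hlt).le) (not_le.2 h0)
          · simp [h0]
        have h2 : (u + 1) * h + x < eventTime (fun t => N t ω) (l + 1) := by
          rw [interarrival] at hx
          rw [← NNReal.coe_lt_coe]
          rw [← NNReal.coe_le_coe] at h1
          push_cast at h1 ⊢
          linarith
        have h3 : N ((u + 1) * h + x) ω < l + 1 := by
          by_contra hlt
          exact absurd (hω.eventTime_le_iff.2 (not_lt.1 hlt)) (not_le.2 h2)
        change N (g u 3) ω - N (g u 2) ω = 0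
        have h4 : g u 3 = (u + 1) * h + x := by simp [hg]
        have h5 : g u 2 = (u + 1) * h := by simp [hg]
        rw [h4, h5]
        omega
    _ ≤ ∑' u, P (C u ∩ {ω | D u 2 ω = 0}) := measure_iUnion_le _
    _ = (∑' u, P (C u)) * ENNReal.ofReal (Real.exp (-(r * x))) := by
        simp only [hprod, ENNReal.tsum_mul_right]
    _ ≤ 1 * ENNReal.ofReal (Real.exp (-(r * x))) := by
        gcongr
        rw [← measure_iUnion₀ hdisj fun u => (hCm u).nullMeasurableSet]
        exact prob_le_one
    _ = _ := one_mul _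

lemma integrable_interarrival (hN : IsPoissonCounter N r P) (hr : 0 < r) (l : ℕ) :
    Integrable (fun ω => interarrival (fun t => N t ω) l) P :=
  (hN.integrable_eventTime hr _).sub (hN.integrable_eventTime hr _)

lemma integral_interarrival (hN : IsPoissonCounter N r P) (hr : 0 < r) (l : ℕ) :
    ∫ ω, interarrival (fun t => N t ω) l ∂P = 1 / r := by
  simp only [interarrival]
  rw [integral_sub (hN.integrable_eventTime hr _) (hN.integrable_eventTime hr _),
    hN.integral_eventTime hr, hN.integral_eventTime hr]
  push_cast
  ring

/-- The interarrival times of a Poisson counter are exponentially distributed. -/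
theorem measureReal_lt_interarrival [IsProbabilityMeasure P] (hN : IsPoissonCounter N r P)
    (hr : 0 < r) (l : ℕ) {x : ℝ} (hx : 0 ≤ x) :
    P.real {ω | x < interarrival (fun t => N t ω) l} = Real.exp (-(r * x)) := by
  have hr' : (0 : ℝ) < r := hr
  set f : ℝ → ℝ := fun x => P.real {ω | x < interarrival (fun t => N t ω) l} with hf
  have hle : ∀ x > 0, f x ≤ Real.exp (-(r * x)) := by
    intro x hx
    have h1 : ∀ᶠ h in 𝓝[>] (0 : ℝ), f x ≤ Real.exp (-(r * (x - h))) := by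
      filter_upwards [Ioo_mem_nhdsGT hx] with h hh
      have h2 := hN.measure_interarrival_add_le hr l (x - h).toNNReal h.toNNReal
        (Real.toNNReal_pos.2 hh.1)
      rw [Real.coe_toNNReal _ (sub_nonneg.2 hh.2.le), Real.coe_toNNReal _ hh.1.le,
        sub_add_cancel] at h2
      exact ENNReal.toReal_le_of_le_ofReal (Real.exp_nonneg _) h2
    refine ge_of_tendsto ?_ h1
    have h3 : Continuous fun h : ℝ => Real.exp (-(r * (x - h))) := by fun_prop
    simpa using (h3.tendsto 0).mono_left nhdsWithin_le_nhds
  have hfm : Antitone f := fun x y hxy => measureReal_mono fun ω hω => lt_of_le_of_lt hxy hω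
  have hexp : IntegrableOn (fun x => Real.exp (-(r * x))) (Set.Ioi 0) := by
    simpa using exp_neg_integrableOn_Ioi 0 hr'
  have hfi : IntegrableOn f (Set.Ioi 0) := by
    refine Integrable.mono' hexp hfm.measurable.aestronglyMeasurable ?_
    filter_upwards [ae_restrict_mem measurableSet_Ioi] with x hx
    rw [Real.norm_of_nonneg measureReal_nonneg]
    exact hle x hx
  have hnn : 0 ≤ᵐ[P] fun ω => interarrival (fun t => N t ω) l := by
    filter_upwards [hN.ae_isRegularPath hr] with ω hω using hω.interarrival_nonneg l
  -- The tail `f` lies below the exponential and both have integral `1 / r`, so they agree almost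
  -- everywhere; monotonicity of `f` and continuity of the exponential then give equality
  -- everywhere.
  have h1 : ∫ x in Set.Ioi 0, f x = 1 / r := by
    rw [← hN.integral_interarrival hr l,
      (hN.integrable_interarrival hr l).integral_eq_integral_meas_lt hnn]
  have h2 : ∫ x in Set.Ioi (0 : ℝ), Real.exp (-(r * x)) = 1 / r := by
    have := integral_exp_mul_Ioi (a := -(r : ℝ)) (by linarith) 0
    simp only [mul_zero, Real.exp_zero, neg_mul] at this
    rw [this]
    field_simp
  have h3 : ∫ x in Set.Ioi (0 : ℝ), (Real.exp (-(r * x)) - f x) = 0 := by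
    rw [integral_sub hexp hfi, h1, h2, sub_self]
  have hsub : IntegrableOn (fun x => Real.exp (-(r * x)) - f x) (Set.Ioi 0) := hexp.sub hfi
  rw [integral_eq_zero_iff_of_nonneg_ae ?_ hsub] at h3
  swap
  · filter_upwards [ae_restrict_mem measurableSet_Ioi] with x hx
    exact sub_nonneg.2 (hle x hx)
  have hge : ∀ x ≥ 0, ∀ y > x, Real.exp (-(r * y)) ≤ f x := by
    intro x hx y hy
    have h4 : ∀ᵐ z ∂(volume.restrict (Set.Ioo x y)), Real.exp (-(r * z)) - f z = 0 :=
      ae_restrict_of_ae_restrict_of_subset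
        (fun z hz => lt_of_le_of_lt hx hz.1) h3
    have h5 : (volume.restrict (Set.Ioo x y)) ≠ 0 := by
      rw [Ne, Measure.restrict_eq_zero, Real.volume_Ioo, ENNReal.ofReal_eq_zero]
      linarith
    have : NeBot (ae (volume.restrict (Set.Ioo x y))) := ae_neBot.2 h5
    obtain ⟨z, hz, hzm⟩ := (h4.and (ae_restrict_mem measurableSet_Ioo)).exists
    calc Real.exp (-(r * y)) ≤ Real.exp (-(r * z)) := by
          apply Real.exp_le_exp.2
          nlinarith [hzm.2]
      _ = f z := by linarith
      _ ≤ f x := hfm hzm.1.le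
  have hgex : ∀ x ≥ 0, Real.exp (-(r * x)) ≤ f x := by
    intro x hx
    have h4 : Continuous fun y : ℝ => Real.exp (-(r * y)) := by fun_prop
    refine le_of_tendsto ((h4.tendsto x).mono_left (nhdsWithin_le_nhds (s := Set.Ioi x))) ?_
    filter_upwards [self_mem_nhdsWithin] with y hy using hge x hx y hy
  rcases hx.eq_or_lt with rfl | hx'
  · exact le_antisymm (by simp [measureReal_le_one]) (hgex 0 le_rfl)
  · exact le_antisymm (hle x hx') (hgex x hx)

end IsPoissonCounter

/-! ### Independence of functions of disjoint sets of coordinates -/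

section DependsOn

variable {Ω α : Type*} [MeasurableSpace Ω] {P : Measure Ω} {Z : α → Ω → ℕ}

open Classical in
lemma exists_eq_comp_restrict_of_dependsOn {F : (α → ℕ) → ℝ} {S : Finset α}
    (hF : DependsOn F S) : ∃ F' : (S → ℕ) → ℝ, ∀ z, F z = F' fun i => z i :=
  ⟨fun y => F fun i => if h : i ∈ S then y ⟨i, h⟩ else 0, fun z => hF fun i hi => by
    rw [dif_pos (Finset.mem_coe.1 hi)]⟩

lemma measurable_comp_of_dependsOn (hZ : ∀ a, Measurable (Z a)) {F : (α → ℕ) → ℝ} {S : Finset α}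
    (hF : DependsOn F S) : Measurable fun ω => F fun a => Z a ω := by
  obtain ⟨F', hF'⟩ := exists_eq_comp_restrict_of_dependsOn hF
  simp only [hF']
  exact (Measurable.of_discrete (f := F')).comp (measurable_pi_lambda _ fun i => hZ i)

lemma indepFun_of_dependsOn (hZ : ∀ a, Measurable (Z a)) (hind : iIndepFun Z P)
    {F G : (α → ℕ) → ℝ} {S T : Finset α} (hF : DependsOn F S) (hG : DependsOn G T)
    (hST : Disjoint S T) :
    IndepFun (fun ω => F fun a => Z a ω) (fun ω => G fun a => Z a ω) P := by
  obtain ⟨F', hF'⟩ := exists_eq_comp_restrict_of_dependsOn hF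
  obtain ⟨G', hG'⟩ := exists_eq_comp_restrict_of_dependsOn hG
  simp only [hF', hG']
  exact (hind.indepFun_finset S T hST hZ).comp (Measurable.of_discrete (f := F'))
    (Measurable.of_discrete (f := G'))

lemma integral_mul_of_dependsOn (hZ : ∀ a, Measurable (Z a)) (hind : iIndepFun Z P)
    {F G : (α → ℕ) → ℝ} {S T : Finset α} (hF : DependsOn F S) (hG : DependsOn G T)
    (hST : Disjoint S T) :
    ∫ ω, F (fun a => Z a ω) * G (fun a => Z a ω) ∂P =
      (∫ ω, F (fun a => Z a ω) ∂P) * ∫ ω, G (fun a => Z a ω) ∂P :=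
  (indepFun_of_dependsOn hZ hind hF hG hST).integral_fun_mul_eq_mul_integral
    (measurable_comp_of_dependsOn hZ hF).aestronglyMeasurable
    (measurable_comp_of_dependsOn hZ hG).aestronglyMeasurable

end DependsOn

/-! ### Pending updates on a grid of independent cells -/

section Grid

/-! Time is cut into cells. A configuration `z` records the number `z (none, u)` of source updates
and the numbers `z (some i, u)` of activations of the in-edges in the cell `u`. -/

variable {ι : Type*}

/-- The number of in-edges that are activated in one of the cells `s, …, e - 1`. -/
noncomputable def activeCount (z : Option ι × ℕ → ℕ) (s e : ℕ) : ℕ :=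
  {i : ι | ∃ u ∈ Finset.Ico s e, z (some i, u) ≠ 0}.ncard

/-- The indicator of the event that fewer than `k` in-edges are activated in `s, …, e - 1`. -/
noncomputable def fewActive (k s e : ℕ) (z : Option ι × ℕ → ℕ) : ℝ :=
  if activeCount z s e < k then 1 else 0

/-- The number of updates in the cells `u ∈ s` such that fewer than `k` in-edges are activated in
the cells `u + d, …, p - 1`. -/
noncomputable def pendingOn (k d : ℕ) (s : Finset ℕ) (p : ℕ) (z : Option ι × ℕ → ℕ) : ℝ :=
  ∑ u ∈ s, (z (none, u) : ℝ) * fewActive k (u + d) p z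

lemma fewActive_nonneg (k s e : ℕ) (z : Option ι × ℕ → ℕ) : 0 ≤ fewActive k s e z := by
  unfold fewActive; split_ifs <;> norm_num

lemma fewActive_le_one (k s e : ℕ) (z : Option ι × ℕ → ℕ) : fewActive k s e z ≤ 1 := by
  unfold fewActive; split_ifs <;> norm_num

lemma fewActive_mul_self (k s e : ℕ) (z : Option ι × ℕ → ℕ) :
    fewActive k s e z * fewActive k s e z = fewActive k s e z := by
  unfold fewActive; split_ifs <;> norm_num

lemma pendingOn_nonneg (k d : ℕ) (s : Finset ℕ) (p : ℕ) (z : Option ι × ℕ → ℕ) :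
    0 ≤ pendingOn k d s p z :=
  Finset.sum_nonneg fun _ _ => mul_nonneg (Nat.cast_nonneg _) (fewActive_nonneg _ _ _ _)

variable {Ω : Type*} [MeasurableSpace Ω] {P : Measure Ω} {Z : Option ι × ℕ → Ω → ℕ}

/-- The statistical properties of the cells: all counts are independent, the source counts
are Poisson of mean `a`, and fewer than `k` edges are activated in `m` given consecutive cells with
probability `φ m`. -/
structure IsGridModel (P : Measure Ω) (Z : Option ι × ℕ → Ω → ℕ) (k : ℕ) (a : ℝ≥0) (φ : ℕ → ℝ) :
    Prop where
  meas : ∀ x, Measurable (Z x)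
  indep : iIndepFun Z P
  source_law : ∀ u, HasLaw (Z (none, u)) (poissonMeasure a) P
  few_prob : ∀ s e, s ≤ e → P.real {ω | activeCount (fun x => Z x ω) s e < k} = φ (e - s)

namespace IsGridModel

variable {k : ℕ} {a : ℝ≥0} {φ : ℕ → ℝ}

lemma isProbabilityMeasure (h : IsGridModel P Z k a φ) : IsProbabilityMeasure P :=
  h.indep.isProbabilityMeasure

lemma memLp_source (h : IsGridModel P Z k a φ) (u : ℕ) :
    MemLp (fun ω => (Z (none, u) ω : ℝ)) 2 P := by
  have := memLp_natCast_poissonMeasure a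
  rw [← (h.source_law u).map_eq] at this
  exact this.comp_of_map (h.source_law u).aemeasurable

lemma integral_source (h : IsGridModel P Z k a φ) (u : ℕ) :
    ∫ ω, (Z (none, u) ω : ℝ) ∂P = a := by
  rw [← integral_natCast_poissonMeasure, ← (h.source_law u).map_eq,
    integral_map (h.source_law u).aemeasurable (by fun_prop)]

lemma integral_source_mul_le (h : IsGridModel P Z k a φ) (u v : ℕ) :
    ∫ ω, (Z (none, u) ω : ℝ) * Z (none, v) ω ∂P ≤ ∫ n : ℕ, (n : ℝ) ^ 2 ∂(poissonMeasure a) := by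
  have hsq : ∀ w, ∫ ω, (Z (none, w) ω : ℝ) ^ 2 ∂P = ∫ n : ℕ, (n : ℝ) ^ 2 ∂(poissonMeasure a) := by
    intro w
    rw [← (h.source_law w).map_eq, integral_map (h.source_law w).aemeasurable (by fun_prop)]
  have h1 := (h.memLp_source u).integrable_sq
  have h2 := (h.memLp_source v).integrable_sq
  calc _ ≤ ∫ ω, ((Z (none, u) ω : ℝ) ^ 2 / 2 + (Z (none, v) ω : ℝ) ^ 2 / 2) ∂P := by
        refine integral_mono ((h.memLp_source u).integrable_mul (h.memLp_source v))
          ((h1.div_const 2).add (h2.div_const 2)) fun ω => ?_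
        have := sq_nonneg ((Z (none, u) ω : ℝ) - Z (none, v) ω)
        linarith
    _ = _ := by
        rw [integral_add (h1.div_const 2) (h2.div_const 2), integral_div, integral_div, hsq, hsq]
        ring

lemma ae_tendsto_average_source (h : IsGridModel P Z k a φ) :
    ∀ᵐ ω ∂P, Tendsto (fun n : ℕ => (∑ p ∈ Finset.range n, (Z (none, p) ω : ℝ)) / n) atTop
      (𝓝 a) := by
  have := h.isProbabilityMeasure
  rw [← h.integral_source 0]
  refine strong_law_ae_real (fun p ω => (Z (none, p) ω : ℝ))
    ((h.memLp_source 0).integrable one_le_two) ?_ ?_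
  · intro u v huv
    exact (h.indep.indepFun (i := (none, u)) (j := (none, v)) (by simpa using huv)).comp
      (φ := fun n : ℕ => (n : ℝ)) (ψ := fun n : ℕ => (n : ℝ)) .of_discrete .of_discrete
  · intro u
    have : IdentDistrib (Z (none, u)) (Z (none, 0)) P P :=
      ⟨(h.meas _).aemeasurable, (h.meas _).aemeasurable, by
        rw [(h.source_law u).map_eq, (h.source_law 0).map_eq]⟩
    exact this.comp (u := fun n : ℕ => (n : ℝ)) .of_discrete

end IsGridModel

variable [Fintype ι]

lemma activeCount_mono {z : Option ι × ℕ → ℕ} {s s' e e' : ℕ} (hs : s' ≤ s) (he : e ≤ e') :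
    activeCount z s e ≤ activeCount z s' e' := by
  refine Set.ncard_le_ncard ?_ (Set.toFinite _)
  rintro i ⟨u, hu, hz⟩
  exact ⟨u, Finset.Ico_subset_Ico hs he hu, hz⟩

lemma fewActive_anti (k : ℕ) {z : Option ι × ℕ → ℕ} {s s' e e' : ℕ} (hs : s' ≤ s) (he : e ≤ e') :
    fewActive k s' e' z ≤ fewActive k s e z := by
  have := activeCount_mono (z := z) hs he
  unfold fewActive
  split_ifs <;> first | omega | norm_num

/-- All coordinates belonging to the cells in `c`. -/
def cells (ι : Type*) [Fintype ι] (c : Finset ℕ) : Finset (Option ι × ℕ) := Finset.univ ×ˢ c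

open Classical in
/-- The coordinates of the in-edges belonging to the cells in `c`. -/
noncomputable def edgeCells (ι : Type*) [Fintype ι] (c : Finset ℕ) : Finset (Option ι × ℕ) :=
  (Finset.univ.image some) ×ˢ c

open Classical in
/-- The coordinates of the source belonging to the cells in `c`. -/
noncomputable def sourceCells (ι : Type*) [Fintype ι] (c : Finset ℕ) : Finset (Option ι × ℕ) :=
  {none} ×ˢ c

lemma disjoint_cells {c c' : Finset ℕ} (h : Disjoint c c') : Disjoint (cells ι c) (cells ι c') :=
  Finset.disjoint_product.2 (Or.inr h)

lemma disjoint_sourceCells_edgeCells (c c' : Finset ℕ) :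
    Disjoint (sourceCells ι c) (edgeCells ι c') :=
  Finset.disjoint_product.2 (Or.inl (by simp))

lemma edgeCells_subset (c : Finset ℕ) : edgeCells ι c ⊆ cells ι c :=
  Finset.product_subset_product (Finset.subset_univ _) subset_rfl

lemma dependsOn_fewActive (k s e : ℕ) {c : Finset ℕ} (hc : Finset.Ico s e ⊆ c) :
    DependsOn (fewActive (ι := ι) k s e) (edgeCells ι c) := by
  intro z z' h
  have : activeCount z s e = activeCount z' s e := by
    unfold activeCount
    congr 1
    ext i
    refine exists_congr fun u => and_congr_right fun hu => ?_
    rw [h _ (by simpa [edgeCells] using hc hu)]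
  simp only [fewActive, this]

lemma dependsOn_pendingOn (k d : ℕ) {s : Finset ℕ} (p : ℕ) {c : Finset ℕ} (hs : s ⊆ c)
    (hc : ∀ u ∈ s, Finset.Ico (u + d) p ⊆ c) :
    DependsOn (pendingOn (ι := ι) k d s p) (cells ι c) := by
  intro z z' h
  refine Finset.sum_congr rfl fun u hu => ?_
  have h1 : fewActive k (u + d) p z = fewActive k (u + d) p z' :=
    dependsOn_fewActive k _ _ (hc u hu) fun a ha =>
      h a (Finset.coe_subset.2 (edgeCells_subset c) ha)
  rw [h1, h _ (by simpa [cells] using hs hu)]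

namespace IsGridModel

variable {k : ℕ} {a : ℝ≥0} {φ : ℕ → ℝ}

lemma measurable_fewActive (h : IsGridModel P Z k a φ) (s e : ℕ) :
    Measurable fun ω => fewActive k s e fun x => Z x ω :=
  measurable_comp_of_dependsOn h.meas (dependsOn_fewActive k s e subset_rfl)

lemma memLp_source_mul (h : IsGridModel P Z k a φ) (u s e : ℕ) :
    MemLp (fun ω => (Z (none, u) ω : ℝ) * fewActive k s e fun x => Z x ω) 2 P := by
  have := h.isProbabilityMeasure
  refine (h.memLp_source u).mono ((h.memLp_source u).aestronglyMeasurable.mul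
    (h.measurable_fewActive s e).aestronglyMeasurable) (ae_of_all _ fun ω => ?_)
  rw [norm_mul, Real.norm_of_nonneg (fewActive_nonneg _ _ _ _)]
  exact mul_le_of_le_one_right (norm_nonneg _) (fewActive_le_one _ _ _ _)

lemma memLp_pendingOn (h : IsGridModel P Z k a φ) (d : ℕ) (s : Finset ℕ) (p : ℕ) :
    MemLp (fun ω => pendingOn k d s p fun x => Z x ω) 2 P :=
  memLp_finsetSum _ fun u _ => h.memLp_source_mul u _ _

lemma integral_fewActive (h : IsGridModel P Z k a φ) {s e : ℕ} (hse : s ≤ e) :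
    ∫ ω, fewActive k s e (fun x => Z x ω) ∂P = φ (e - s) := by
  rw [← h.few_prob s e hse, ← integral_indicator_one]
  · refine integral_congr_ae (ae_of_all _ fun ω => ?_)
    simp [fewActive, Set.indicator_apply]
  · have : {ω | activeCount (fun x => Z x ω) s e < k} =
      (fun ω => fewActive k s e fun x => Z x ω) ⁻¹' {1} := by
      ext ω
      simp [fewActive]
    rw [this]
    exact h.measurable_fewActive s e (measurableSet_singleton _)

lemma integral_source_mul_fewActive (h : IsGridModel P Z k a φ) (u : ℕ) {s e : ℕ} (hse : s ≤ e) :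
    ∫ ω, (Z (none, u) ω : ℝ) * fewActive k s e (fun x => Z x ω) ∂P = a * φ (e - s) := by
  have h1 : DependsOn (fun z : Option ι × ℕ → ℕ => (z (none, u) : ℝ)) (sourceCells ι {u}) := by
    intro z z' hz
    simp only
    rw [hz _ (by simp [sourceCells])]
  rw [integral_mul_of_dependsOn h.meas h.indep h1 (dependsOn_fewActive k s e subset_rfl)
    (disjoint_sourceCells_edgeCells _ _), h.integral_source, h.integral_fewActive hse]

/-- The index `m` is the number of cells strictly between the cell of the update and `p`; the source
count there is independent of the edges. -/
lemma integral_pendingOn_range (h : IsGridModel P Z k a φ) {d : ℕ} (hd : d ≤ 1) (p : ℕ) :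
    ∫ ω, pendingOn k d (Finset.range p) p (fun x => Z x ω) ∂P =
      a * ∑ m ∈ Finset.range p, φ (m + 1 - d) := by
  have := h.isProbabilityMeasure
  unfold pendingOn
  rw [integral_finsetSum _ fun u _ => (h.memLp_source_mul u _ _).integrable one_le_two, ← Finset.sum_range_reflect,
    Finset.mul_sum]
  refine Finset.sum_congr rfl fun m hm => ?_
  have := Finset.mem_range.1 hm
  rw [h.integral_source_mul_fewActive _ (by omega)]
  congr 2
  omega

/-- The probability that two updates are both pending is at most each single one, hence at most the
geometric mean of the two. Bounding `φ` by a square makes this mean a product, so the double sum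
factors into the square of a geometric series, uniformly in `p`. -/
lemma integral_sq_pendingOn_le (h : IsGridModel P Z k a φ) {d : ℕ} (hd : d ≤ 1) {c ρ : ℝ}
    (hc : 0 ≤ c) (hρ0 : 0 ≤ ρ) (hρ1 : ρ < 1) (hφ : ∀ m, φ m ≤ (c * ρ ^ m) ^ 2) (p : ℕ) :
    ∫ ω, pendingOn k d (Finset.range p) p (fun x => Z x ω) ^ 2 ∂P ≤
      (∫ n : ℕ, (n : ℝ) ^ 2 ∂(poissonMeasure a)) * (c * (1 / (1 - ρ))) ^ 2 := by
  have := h.isProbabilityMeasure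
  set M := ∫ n : ℕ, (n : ℝ) ^ 2 ∂(poissonMeasure a) with hM
  have hM0 : 0 ≤ M := integral_nonneg fun n => by positivity
  have hsum : ∑ u ∈ Finset.range p, c * ρ ^ (p - (u + d)) ≤ c * (1 / (1 - ρ)) := by
    rw [← Finset.mul_sum, ← Finset.sum_range_reflect]
    refine mul_le_mul_of_nonneg_left ?_ hc
    calc _ ≤ ∑ i ∈ Finset.range p, ρ ^ i := Finset.sum_le_sum fun i hi => by
          have := Finset.mem_range.1 hi
          apply pow_le_pow_of_le_one hρ0 hρ1.le
          omega
      _ ≤ ∑' i, ρ ^ i := (summable_geometric_of_lt_one hρ0 hρ1).sum_le_tsum _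
          fun i _ => pow_nonneg hρ0 i
      _ = _ := by rw [tsum_geometric_of_lt_one hρ0 hρ1, one_div]
  have hterm : ∀ u ∈ Finset.range p, ∀ v ∈ Finset.range p,
      ∫ ω, ((Z (none, u) ω : ℝ) * fewActive k (u + d) p (fun x => Z x ω)) *
        ((Z (none, v) ω : ℝ) * fewActive k (v + d) p (fun x => Z x ω)) ∂P ≤
      M * ((c * ρ ^ (p - (u + d))) * (c * ρ ^ (p - (v + d)))) := by
    intro u hu v hv
    have hu := Finset.mem_range.1 hu
    have hv := Finset.mem_range.1 hv
    have h1 : DependsOn (fun z : Option ι × ℕ → ℕ => (z (none, u) : ℝ) * z (none, v))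
        (sourceCells ι {u, v}) := by
      intro z z' hz
      simp only
      rw [hz _ (by simp [sourceCells]), hz _ (by simp [sourceCells])]
    have h2 : DependsOn (fun z : Option ι × ℕ → ℕ =>
        fewActive k (u + d) p z * fewActive k (v + d) p z) (edgeCells ι (Finset.range p)) := by
      intro z z' hz
      have hsub : ∀ s, Finset.Ico s p ⊆ Finset.range p := fun s x hx => by
        simp at hx ⊢; exact hx.2
      simp only
      rw [dependsOn_fewActive k (u + d) p (hsub _) hz, dependsOn_fewActive k (v + d) p (hsub _) hz]
    have hi : ∀ s, Integrable (fun ω => fewActive k s p fun x => Z x ω) P := fun s =>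
      (integrable_const (1 : ℝ)).mono (h.measurable_fewActive s p).aestronglyMeasurable
        (ae_of_all _ fun ω => by
          rw [Real.norm_of_nonneg (fewActive_nonneg _ _ _ _), norm_one]
          exact fewActive_le_one _ _ _ _)
    have h3 : ∫ ω, fewActive k (u + d) p (fun x => Z x ω) *
        fewActive k (v + d) p (fun x => Z x ω) ∂P ≤
        (c * ρ ^ (p - (u + d))) * (c * ρ ^ (p - (v + d))) := by
      have hnn : 0 ≤ ∫ ω, fewActive k (u + d) p (fun x => Z x ω) *
          fewActive k (v + d) p (fun x => Z x ω) ∂P := integral_nonneg fun ω =>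
        mul_nonneg (fewActive_nonneg _ _ _ _) (fewActive_nonneg _ _ _ _)
      have hA : ∫ ω, fewActive k (u + d) p (fun x => Z x ω) *
          fewActive k (v + d) p (fun x => Z x ω) ∂P ≤ (c * ρ ^ (p - (u + d))) ^ 2 := by
        refine le_trans ?_ (hφ _)
        rw [← h.integral_fewActive (show u + d ≤ p by omega)]
        exact integral_mono_of_nonneg (ae_of_all _ fun ω =>
          mul_nonneg (fewActive_nonneg _ _ _ _) (fewActive_nonneg _ _ _ _)) (hi _)
          (ae_of_all _ fun ω => mul_le_of_le_one_right (fewActive_nonneg _ _ _ _)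
            (fewActive_le_one _ _ _ _))
      have hB : ∫ ω, fewActive k (u + d) p (fun x => Z x ω) *
          fewActive k (v + d) p (fun x => Z x ω) ∂P ≤ (c * ρ ^ (p - (v + d))) ^ 2 := by
        refine le_trans ?_ (hφ _)
        rw [← h.integral_fewActive (show v + d ≤ p by omega)]
        exact integral_mono_of_nonneg (ae_of_all _ fun ω =>
          mul_nonneg (fewActive_nonneg _ _ _ _) (fewActive_nonneg _ _ _ _)) (hi _)
          (ae_of_all _ fun ω => mul_le_of_le_one_left (fewActive_nonneg _ _ _ _)
            (fewActive_le_one _ _ _ _))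
      have hAB := mul_le_mul hA hB hnn (by positivity)
      refine abs_le_of_sq_le_sq' ?_ (by positivity) |>.2
      linarith [hAB]
    calc _ = ∫ ω, ((Z (none, u) ω : ℝ) * Z (none, v) ω) *
          (fewActive k (u + d) p (fun x => Z x ω) * fewActive k (v + d) p (fun x => Z x ω)) ∂P := by
          congr 1 with ω
          ring
      _ = _ := integral_mul_of_dependsOn h.meas h.indep h1 h2 (disjoint_sourceCells_edgeCells _ _)
      _ ≤ _ := by
          refine mul_le_mul (h.integral_source_mul_le u v) h3 (integral_nonneg fun ω =>
            mul_nonneg (fewActive_nonneg _ _ _ _) (fewActive_nonneg _ _ _ _)) hM0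
  have hint : ∀ u v, Integrable (fun ω =>
      ((Z (none, u) ω : ℝ) * fewActive k (u + d) p (fun x => Z x ω)) *
        ((Z (none, v) ω : ℝ) * fewActive k (v + d) p (fun x => Z x ω))) P := fun u v =>
    (h.memLp_source_mul u _ _).integrable_mul (h.memLp_source_mul v _ _)
  calc _ = ∑ u ∈ Finset.range p, ∑ v ∈ Finset.range p,
        ∫ ω, ((Z (none, u) ω : ℝ) * fewActive k (u + d) p (fun x => Z x ω)) *
          ((Z (none, v) ω : ℝ) * fewActive k (v + d) p (fun x => Z x ω)) ∂P := by
        simp only [pendingOn, pow_two, Finset.sum_mul_sum]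
        rw [integral_finsetSum _ fun u _ => integrable_finsetSum _ fun v _ => hint u v]
        exact Finset.sum_congr rfl fun u _ => integral_finsetSum _ fun v _ => hint u v
    _ ≤ ∑ u ∈ Finset.range p, ∑ v ∈ Finset.range p,
        M * ((c * ρ ^ (p - (u + d))) * (c * ρ ^ (p - (v + d)))) :=
        Finset.sum_le_sum fun u hu => Finset.sum_le_sum fun v hv => hterm u hu v hv
    _ = M * (∑ u ∈ Finset.range p, c * ρ ^ (p - (u + d))) ^ 2 := by
        rw [pow_two, Finset.sum_mul_sum, Finset.mul_sum]
        simp only [Finset.mul_sum]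
    _ ≤ _ := by
        refine mul_le_mul_of_nonneg_left (pow_le_pow_left₀ ?_ hsum 2) hM0
        exact Finset.sum_nonneg fun u _ => by positivity

/-- An update older than `p` and pending at `q` was pending at `p`, and fewer than `k` edges were
activated between `p` and `q`. The rest is new and lives on cells from `p` on. -/
lemma pendingOn_range_le {d : ℕ} (hd : d ≤ 1) {p q : ℕ} (hpq : p ≤ q) (z : Option ι × ℕ → ℕ) :
    pendingOn k d (Finset.range q) q z ≤
      pendingOn k d (Finset.range p) p z * fewActive k p q z +
        pendingOn k d (Finset.Ico p q) q z := by
  have h1 : pendingOn k d (Finset.range q) q z =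
      pendingOn k d (Finset.range p) q z + pendingOn k d (Finset.Ico p q) q z := by
    simp only [pendingOn, Finset.sum_range_add_sum_Ico _ hpq]
  rw [h1]
  refine add_le_add_left ?_ _
  simp only [pendingOn, Finset.sum_mul]
  refine Finset.sum_le_sum fun u hu => ?_
  have hu := Finset.mem_range.1 hu
  rw [mul_assoc]
  refine mul_le_mul_of_nonneg_left ?_ (Nat.cast_nonneg _)
  rw [← fewActive_mul_self]
  exact mul_le_mul (fewActive_anti k le_rfl hpq) (fewActive_anti k (by omega) le_rfl)
    (fewActive_nonneg _ _ _ _) (fewActive_nonneg _ _ _ _)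

/-- With `W' ≤ W * I + V`, both `I` and `V` depend only on cells from `p` on, so they are
independent of `W`. The term `W * V` gives the product of means, since `V ≤ W'`, and `W ^ 2 * I`
gives the geometrically small error. -/
lemma integral_pendingOn_mul_le (h : IsGridModel P Z k a φ) {d : ℕ} (hd : d ≤ 1) {c ρ : ℝ}
    (hc : 0 ≤ c) (hρ0 : 0 ≤ ρ) (hρ1 : ρ < 1) (hφ : ∀ m, φ m ≤ (c * ρ ^ m) ^ 2) {p q : ℕ}
    (hpq : p ≤ q) :
    ∫ ω, pendingOn k d (Finset.range p) p (fun x => Z x ω) *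
        pendingOn k d (Finset.range q) q (fun x => Z x ω) ∂P ≤
      (∫ ω, pendingOn k d (Finset.range p) p (fun x => Z x ω) ∂P) *
        (∫ ω, pendingOn k d (Finset.range q) q (fun x => Z x ω) ∂P) +
      (∫ n : ℕ, (n : ℝ) ^ 2 ∂(poissonMeasure a)) * (c * (1 / (1 - ρ))) ^ 2 * c ^ 2 *
        (ρ ^ 2) ^ (q - p) := by
  have := h.isProbabilityMeasure
  set W := fun ω => pendingOn k d (Finset.range p) p (fun x => Z x ω)
  set W' := fun ω => pendingOn k d (Finset.range q) q (fun x => Z x ω)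
  set V := fun ω => pendingOn k d (Finset.Ico p q) q (fun x => Z x ω)
  set I := fun ω => fewActive k p q (fun x => Z x ω)
  have hW : MemLp W 2 P := h.memLp_pendingOn _ _ _
  have hW' : MemLp W' 2 P := h.memLp_pendingOn _ _ _
  have hV : MemLp V 2 P := h.memLp_pendingOn _ _ _
  have hWI : Integrable (fun ω => W ω ^ 2 * I ω) P := by
    refine hW.integrable_sq.mono (hW.integrable_sq.aestronglyMeasurable.mul
      (h.measurable_fewActive p q).aestronglyMeasurable) (ae_of_all _ fun ω => ?_)
    rw [norm_mul, Real.norm_of_nonneg (fewActive_nonneg _ _ _ _)]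
    exact mul_le_of_le_one_right (norm_nonneg _) (fewActive_le_one _ _ _ _)
  have hdW : DependsOn (pendingOn (ι := ι) k d (Finset.range p) p) (cells ι (Finset.range p)) :=
    dependsOn_pendingOn k d p subset_rfl fun u _ x hx => by simp at hx ⊢; exact hx.2
  have hdV : DependsOn (pendingOn (ι := ι) k d (Finset.Ico p q) q) (cells ι (Finset.Ico p q)) :=
    dependsOn_pendingOn k d q subset_rfl fun u hu => Finset.Ico_subset_Ico_left (by
      have := (Finset.mem_Ico.1 hu).1
      omega)
  have hdisj : Disjoint (Finset.range p) (Finset.Ico p q) := by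
    rw [Finset.range_eq_Ico]
    exact Finset.Ico_disjoint_Ico_consecutive 0 p q
  have h1 : ∫ ω, W ω ^ 2 * I ω ∂P = (∫ ω, W ω ^ 2 ∂P) * φ (q - p) := by
    rw [← h.integral_fewActive hpq]
    have hd2 : DependsOn (fun z => pendingOn (ι := ι) k d (Finset.range p) p z ^ 2)
        (cells ι (Finset.range p)) := fun z z' hz => by simp only; rw [hdW hz]
    have hdI : DependsOn (fewActive (ι := ι) k p q) (cells ι (Finset.Ico p q)) := fun z z' hz =>
      dependsOn_fewActive k p q subset_rfl fun x hx =>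
        hz x (Finset.coe_subset.2 (edgeCells_subset _) hx)
    exact integral_mul_of_dependsOn h.meas h.indep hd2 hdI (disjoint_cells hdisj)
  have h2 : ∫ ω, W ω * V ω ∂P = (∫ ω, W ω ∂P) * ∫ ω, V ω ∂P :=
    integral_mul_of_dependsOn h.meas h.indep hdW hdV (disjoint_cells hdisj)
  have h3 : ∫ ω, V ω ∂P ≤ ∫ ω, W' ω ∂P := by
    refine integral_mono (hV.integrable one_le_two) (hW'.integrable one_le_two) fun ω => ?_
    refine Finset.sum_le_sum_of_subset_of_nonneg (fun x hx => ?_) fun _ _ _ =>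
      mul_nonneg (Nat.cast_nonneg _) (fewActive_nonneg _ _ _ _)
    simp at hx ⊢
    exact hx.2
  calc ∫ ω, W ω * W' ω ∂P ≤ ∫ ω, (W ω ^ 2 * I ω + W ω * V ω) ∂P := by
        refine integral_mono (hW.integrable_mul hW') (hWI.add (hW.integrable_mul hV)) fun ω => ?_
        have hle : W' ω ≤ W ω * I ω + V ω := pendingOn_range_le hd hpq _
        have := mul_le_mul_of_nonneg_left hle (pendingOn_nonneg k d (Finset.range p) p
          (fun x => Z x ω))
        refine this.trans_eq ?_
        change W ω * (W ω * I ω + V ω) = W ω ^ 2 * I ω + W ω * V ω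
        ring
    _ = (∫ ω, W ω ^ 2 ∂P) * φ (q - p) + (∫ ω, W ω ∂P) * ∫ ω, V ω ∂P := by
        have hWV : Integrable (fun ω => W ω * V ω) P := hW.integrable_mul hV
        rw [integral_add hWI hWV, h1, ← h2]
    _ ≤ (∫ n : ℕ, (n : ℝ) ^ 2 ∂(poissonMeasure a)) * (c * (1 / (1 - ρ))) ^ 2 *
          (c * ρ ^ (q - p)) ^ 2 + (∫ ω, W ω ∂P) * ∫ ω, W' ω ∂P := by
        refine add_le_add (mul_le_mul (h.integral_sq_pendingOn_le hd hc hρ0 hρ1 hφ p) (hφ _) ?_ ?_)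
          (mul_le_mul_of_nonneg_left h3 (integral_nonneg fun ω => pendingOn_nonneg _ _ _ _ _))
        · rw [← h.integral_fewActive hpq]
          exact integral_nonneg fun ω => fewActive_nonneg _ _ _ _
        · exact mul_nonneg (integral_nonneg fun n => by positivity) (sq_nonneg _)
    _ = _ := by rw [← pow_mul, mul_comm 2 (q - p), pow_mul]; ring

/-- The law of large numbers for the number of pending updates. -/
theorem ae_tendsto_average_pendingOn (h : IsGridModel P Z k a φ) {d : ℕ} (hd : d ≤ 1) {c ρ : ℝ}
    (hc : 0 ≤ c) (hρ0 : 0 ≤ ρ) (hρ1 : ρ < 1) (hφ0 : ∀ m, 0 ≤ φ m)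
    (hφ : ∀ m, φ m ≤ (c * ρ ^ m) ^ 2) :
    ∀ᵐ ω ∂P, Tendsto (fun n : ℕ =>
      (∑ p ∈ Finset.range n, pendingOn k d (Finset.range p) p (fun x => Z x ω)) / n) atTop
      (𝓝 (a * ∑' m, φ (m + 1 - d))) := by
  have := h.isProbabilityMeasure
  have hρ2 : ρ ^ 2 < 1 := by nlinarith
  have hsum : Summable φ := by
    refine Summable.of_nonneg_of_le hφ0 hφ ?_
    have : (fun m => (c * ρ ^ m) ^ 2) = fun m => c ^ 2 * (ρ ^ 2) ^ m := by
      ext m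
      rw [mul_pow, ← pow_mul, ← pow_mul, mul_comm m]
    rw [this]
    exact (summable_geometric_of_lt_one (sq_nonneg _) hρ2).mul_left _
  have hsum' : Summable fun m => φ (m + 1 - d) := by
    interval_cases d
    · exact (summable_nat_add_iff 1).2 hsum
    · simpa using hsum
  refine ae_tendsto_average_of_covariance_le (fun p => h.memLp_pendingOn d _ p)
    (fun p ω => pendingOn_nonneg _ _ _ _ _) ?_ (sq_nonneg ρ) hρ2
    (fun p q hpq => h.integral_pendingOn_mul_le hd hc hρ0 hρ1 hφ hpq) ?_
  · exact mul_nonneg (mul_nonneg (integral_nonneg fun n => by positivity) (sq_nonneg _))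
      (sq_nonneg _)
  · simp only [h.integral_pendingOn_range hd]
    exact hsum'.hasSum.tendsto_sum_nat.const_mul _

end IsGridModel

end Grid

/-! ### Pathwise sandwich of the version age -/

section Pathwise

variable {V : Type*} {G : Digraph (Option V)} {k n : ℕ} {keyOf : ℕ → V ≃ Fin n}
  {c₀ : ℝ≥0 → ℕ} {c : V → V → ℝ≥0 → ℕ} {j : V}

lemma exists_jumpTime {c : ℝ≥0 → ℕ} (hc : IsRegularPath c) {s t : ℝ≥0} (h : c s < c t) :
    ∃ a ∈ jumpTimes c, s < a ∧ a ≤ t := by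
  have hsa : s < eventTime c (c t) := by
    rw [← not_le, hc.eventTime_le_iff]
    omega
  refine ⟨eventTime c (c t), ⟨bot_le.trans_lt hsa, fun x hx => ?_⟩, hsa,
    hc.eventTime_le_iff.2 le_rfl⟩
  have h1 := hc.eventTime_le_iff.1 (le_refl (eventTime c (c t)))
  rw [← not_le, hc.eventTime_le_iff] at hx
  omega

/-- A version generated before some activation of an edge is sent over this edge no later. -/
lemma exists_mem_sentVersions {c : ℝ≥0 → ℕ} {a : ℝ≥0} (ha : a ∈ jumpTimes c) {l : ℕ}
    (hl : l ≤ c₀ a) : ∃ a' ∈ jumpTimes c, a' ≤ a ∧ l ∈ sentVersions c₀ c a' := by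
  set S : Set ℝ≥0 := {a' | a' ∈ jumpTimes c ∧ a' ≤ a ∧ l ≤ c₀ a'}
  have hne : S.Nonempty := ⟨a, ha, le_rfl, hl⟩
  -- Minimising the integer `c a'` yields the earliest admissible activation, because `c` increases
  -- strictly at each jump time.
  have hmem := Function.argminOn_mem c S hne
  have hmin := fun b (hb : b ∈ S) => Function.argminOn_le c S hb
  set a' := Function.argminOn c S hne
  refine ⟨a', hmem.1, hmem.2.1, hmem.2.2, fun b hb hba => ?_⟩
  by_contra hlt
  have h1 := hmin b ⟨hb, hba.le.trans hmem.2.1, not_lt.1 hlt⟩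
  exact absurd (hmem.1.2 b hba) (not_lt.2 h1)

lemma le_of_mem_heldKeys (h₀ : Monotone c₀) {l : ℕ} {t : ℝ≥0} {x : Fin n}
    (hx : x ∈ heldKeys G keyOf c₀ c j l t) : l ≤ c₀ t := by
  rcases hx with ⟨-, h⟩ | ⟨i, -, -, a, -, hat, hl, -⟩
  · exact h
  · exact hl.trans (h₀ hat)

lemma le_of_lt_ncard_heldKeys (h₀ : Monotone c₀) {l : ℕ} {t : ℝ≥0}
    (h : k + 1 ≤ (heldKeys G keyOf c₀ c j l t).ncard) : l ≤ c₀ t := by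
  obtain ⟨x, hx⟩ := Set.nonempty_of_ncard_ne_zero (show
    (heldKeys G keyOf c₀ c j l t).ncard ≠ 0 by omega)
  exact le_of_mem_heldKeys h₀ hx

lemma latestDecoded_le_of_forall {m : ℕ} {t : ℝ≥0}
    (h : ∀ l, k + 1 ≤ (heldKeys G keyOf c₀ c j l t).ncard → l ≤ m) :
    latestDecoded G k keyOf c₀ c j t ≤ m := by
  rcases Set.eq_empty_or_nonempty {l | k + 1 ≤ (heldKeys G keyOf c₀ c j l t).ncard} with h0 | h0
  · rw [latestDecoded, h0, csSup_empty]
    exact bot_le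
  · exact csSup_le h0 h

lemma latestDecoded_le (h₀ : Monotone c₀) (t : ℝ≥0) :
    latestDecoded G k keyOf c₀ c j t ≤ c₀ t :=
  latestDecoded_le_of_forall fun _ => le_of_lt_ncard_heldKeys h₀

/-- If fewer than `k` in-edges are activated during `(s, t]`, then at time `t` no version generated
after `s` can be decoded. -/
lemma latestDecoded_le_of_ncard_lt (h₀ : Monotone c₀)
    (hc : ∀ i ∈ inNeighbors G j, Monotone (c i j)) {s t : ℝ≥0}
    (h : {i ∈ inNeighbors G j | c i j s < c i j t}.ncard < k) :
    latestDecoded G k keyOf c₀ c j t ≤ c₀ s := by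
  refine latestDecoded_le_of_forall fun l hl => ?_
  by_contra hlt
  rw [not_le] at hlt
  -- Besides its own key, node `j` can only hold the keys of in-neighbors active in `(s, t]`: at
  -- most `k` keys in all.
  have hsub : heldKeys G keyOf c₀ c j l t ⊆
      insert (keyOf l j) (keyOf l '' {i ∈ inNeighbors G j | c i j s < c i j t}) := by
    rintro x (⟨hx, -⟩ | ⟨i, hi, rfl, a, ha, hat, hla, -⟩)
    · exact Or.inl hx
    · refine Or.inr ⟨i, ⟨hi, ?_⟩, rfl⟩
      have hsa : s < a := by
        by_contra hsa
        exact absurd (hla.trans (h₀ (not_lt.1 hsa))) (not_le.2 hlt)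
      exact (ha.2 s hsa).trans_le (hc i hi hat)
  have h1 := Set.ncard_le_ncard hsub (Set.toFinite _)
  have h2 := Set.ncard_insert_le (keyOf l j) (keyOf l '' {i ∈ inNeighbors G j | c i j s < c i j t})
  rw [Set.ncard_image_of_injective _ (keyOf l).injective] at h2
  omega

/-- If at least `k` in-edges are activated during `(s, t]`, then at time `t` every version generated
up to time `s` can be decoded. -/
lemma le_latestDecoded_of_le_ncard (hG : ∀ v, ¬ G.Adj v v) (h₀ : Monotone c₀)
    (hc : ∀ i ∈ inNeighbors G j, IsRegularPath (c i j)) {s t : ℝ≥0} (hst : s ≤ t)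
    (h : k ≤ {i ∈ inNeighbors G j | c i j s < c i j t}.ncard) :
    c₀ s ≤ latestDecoded G k keyOf c₀ c j t := by
  refine le_csSup ⟨c₀ t, fun l hl => le_of_lt_ncard_heldKeys h₀ hl⟩ ?_
  have hsub : insert (keyOf (c₀ s) j)
      (keyOf (c₀ s) '' {i ∈ inNeighbors G j | c i j s < c i j t}) ⊆
      heldKeys G keyOf c₀ c j (c₀ s) t := by
    rintro x (rfl | ⟨i, ⟨hi, hact⟩, rfl⟩)
    · exact Or.inl ⟨rfl, h₀ hst⟩
    · obtain ⟨a, ha, hsa, hat⟩ := exists_jumpTime (hc i hi) hact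
      obtain ⟨a', ha', haa, hsent⟩ := exists_mem_sentVersions ha (h₀ hsa.le)
      exact Or.inr ⟨i, hi, rfl, a', ha', haa.trans hat, hsent⟩
  have h1 := Set.ncard_le_ncard hsub (Set.toFinite _)
  rw [Set.ncard_insert_of_notMem, Set.ncard_image_of_injective _ (keyOf _).injective] at h1
  · change k + 1 ≤ _
    omega
  -- Without self-loops `j` is not its own in-neighbor, so the source's key is one more key.
  · rintro ⟨i, ⟨hi, -⟩, hij⟩
    rw [(keyOf _).injective hij] at hi
    exact hG _ hi

lemma latestDecoded_mono (h₀ : Monotone c₀) :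
    Monotone (latestDecoded G k keyOf c₀ c j) := by
  intro s t hst
  refine latestDecoded_le_of_forall fun l hl =>
    le_csSup ⟨c₀ t, fun l hl => le_of_lt_ncard_heldKeys h₀ hl⟩ (hl.trans ?_)
  refine Set.ncard_le_ncard ?_ (Set.toFinite _)
  rintro x (⟨hx, hl⟩ | ⟨i, hi, hx, a, ha, hat, hla⟩)
  · exact Or.inl ⟨hx, hl.trans (h₀ hst)⟩
  · exact Or.inr ⟨i, hi, hx, a, ha, hat.trans hst, hla⟩

lemma versionAge_nonneg (h₀ : Monotone c₀) (t : ℝ≥0) : 0 ≤ versionAge G k keyOf c₀ c j t := by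
  have h := latestDecoded_le (G := G) (k := k) (keyOf := keyOf) (c := c) (j := j) h₀ t
  rw [versionAge, sub_nonneg]
  exact_mod_cast h

lemma intervalIntegrable_versionAge (h₀ : Monotone c₀) (a b : ℝ) :
    IntervalIntegrable (fun s : ℝ => versionAge G k keyOf c₀ c j s.toNNReal) volume a b := by
  have h1 : Monotone fun s : ℝ => (c₀ s.toNNReal : ℝ) := fun s t hst =>
    Nat.mono_cast (h₀ (Real.toNNReal_le_toNNReal hst))
  have h2 : Monotone fun s : ℝ => (latestDecoded G k keyOf c₀ c j s.toNNReal : ℝ) := fun s t hst =>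
    Nat.mono_cast (latestDecoded_mono h₀ (Real.toNNReal_le_toNNReal hst))
  exact h1.intervalIntegrable.sub h2.intervalIntegrable

/-- The configuration of the cells of length `h` for the given paths. -/
def cellCounts (G : Digraph (Option V)) (c₀ : ℝ≥0 → ℕ) (c : V → V → ℝ≥0 → ℕ) (j : V) (h : ℝ≥0) :
    Option (inNeighbors G j) × ℕ → ℕ
  | (none, u) => c₀ ((u + 1) * h) - c₀ (u * h)
  | (some i, u) => c i j ((u + 1) * h) - c i j (u * h)

lemma activeCount_cellCounts (hc : ∀ i ∈ inNeighbors G j, Monotone (c i j)) (h : ℝ≥0)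
    {s e : ℕ} (hse : s ≤ e) :
    activeCount (cellCounts G c₀ c j h) s e =
      {i ∈ inNeighbors G j | c i j (s * h) < c i j (e * h)}.ncard := by
  have himg : {i ∈ inNeighbors G j | c i j (s * h) < c i j (e * h)} =
      Subtype.val '' {i : inNeighbors G j |
        ∃ u ∈ Finset.Ico s e, cellCounts G c₀ c j h (some i, u) ≠ 0} := by
    ext i
    constructor
    · rintro ⟨hi, hlt⟩
      refine ⟨⟨i, hi⟩, ?_, rfl⟩
      by_contra hno
      have hno' : ∀ u ∈ Finset.Ico s e, c i j ((u + 1) * h) - c i j (u * h) = 0 := by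
        intro u hu
        by_contra h0
        exact hno ⟨u, hu, h0⟩
      have : ∀ m, s + m ≤ e → c i j ((s + m : ℕ) * h) ≤ c i j (s * h) := by
        intro m
        induction m with
        | zero => intro _; simp
        | succ m ih =>
          intro hm
          have h1 := ih (by omega)
          have h2 := hno' (s + m) (Finset.mem_Ico.2 ⟨by omega, by omega⟩)
          have h3 : ((s + (m + 1) : ℕ) : ℝ≥0) = (s + m : ℕ) + 1 := by push_cast; ring
          rw [h3]
          omega
      have h4 := this (e - s) (by omega)
      rw [Nat.add_sub_cancel' hse] at h4
      omega
    · rintro ⟨⟨i, hi⟩, ⟨u, hu, hne⟩, rfl⟩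
      have hu := Finset.mem_Ico.1 hu
      refine ⟨hi, ?_⟩
      have h1 : c i j (s * h) ≤ c i j (u * h) := hc i hi (by gcongr; exact hu.1)
      have h2 : c i j ((u + 1) * h) ≤ c i j (e * h) := hc i hi (by
        gcongr
        exact_mod_cast hu.2)
      have h3 : c i j ((u + 1) * h) - c i j (u * h) ≠ 0 := hne
      change c i j (s * h) < c i j (e * h)
      omega
  rw [himg, Set.ncard_image_of_injective _ Subtype.val_injective]
  rfl

lemma sum_Ico_cellCounts (h₀ : Monotone c₀) (h : ℝ≥0) {s e : ℕ} (hse : s ≤ e) :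
    ∑ u ∈ Finset.Ico s e, (cellCounts G c₀ c j h (none, u) : ℝ) = c₀ (e * h) - c₀ (s * h) := by
  have : ∀ u : ℕ, (cellCounts G c₀ c j h (none, u) : ℝ) =
      c₀ ((u + 1 : ℕ) * h) - c₀ (u * h) := by
    intro u
    rw [Nat.cast_succ]
    exact Nat.cast_sub (h₀ (by gcongr; simp))
  simp only [this]
  exact Finset.sum_Ico_sub (fun u : ℕ => (c₀ (u * h) : ℝ)) hse

variable [Finite V]

/-- With `d = 1` only activations in the cells after that of the update and before `p` are counted,
which overestimates pending updates; all updates of the current cell are added. -/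
lemma versionAge_le (hk : 1 ≤ k) (hG : ∀ v, ¬ G.Adj v v) (h₀ : Monotone c₀) (h0 : c₀ 0 = 0)
    (hc : ∀ i ∈ inNeighbors G j, IsRegularPath (c i j)) (h : ℝ≥0) (p : ℕ) {t : ℝ≥0}
    (ht1 : p * h ≤ t) (ht2 : t ≤ (p + 1) * h) :
    versionAge G k keyOf c₀ c j t ≤
      cellCounts G c₀ c j h (none, p) +
        pendingOn k 1 (Finset.range p) p (cellCounts G c₀ c j h) := by
  have : Fintype (inNeighbors G j) := Fintype.ofFinite _
  set z := cellCounts G c₀ c j h with hz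
  have hmono : ∀ i ∈ inNeighbors G j, Monotone (c i j) := fun i hi => (hc i hi).mono
  have hself : activeCount z p p < k := by
    simp only [activeCount, Finset.Ico_self]
    simpa using Nat.pos_of_ne_zero (by omega)
  have hup : cellCounts G c₀ c j h (none, p) + pendingOn k 1 (Finset.range p) p z =
      pendingOn k 1 (Finset.range (p + 1)) p z := by
    have h1 : fewActive k (p + 1) p z = 1 := if_pos (by
      simpa [activeCount] using Nat.pos_of_ne_zero (by omega))
    simp only [pendingOn, Finset.sum_range_succ _ p, h1, mul_one]
    rw [add_comm]
  rw [hup]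
  -- Take the largest `u` such that `k` edges are active from cell `u` on: everything up to `u * h`
  -- is decoded, and every later cell is still counted as pending. If there is none, `u = 0` works
  -- because `c₀ 0 = 0`.
  obtain ⟨u, hup, hu1, hu2⟩ : ∃ u ≤ p, c₀ (u * h) ≤ latestDecoded G k keyOf c₀ c j t ∧
      ∀ v, u ≤ v → v ≤ p → activeCount z (v + 1) p < k := by
    by_cases hex : ∃ u ≤ p, k ≤ activeCount z u p
    · classical
      obtain ⟨u0, hu0p, hu0⟩ := hex
      have hspec := Nat.findGreatest_spec (P := fun u => k ≤ activeCount z u p) hu0p hu0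
      have hle := Nat.findGreatest_le (P := fun u => k ≤ activeCount z u p) p
      have hmax := fun v => Nat.findGreatest_is_greatest
        (P := fun u => k ≤ activeCount z u p) (n := p) (k := v)
      set u := Nat.findGreatest (fun u => k ≤ activeCount z u p) p
      refine ⟨u, hle, ?_, fun v huv hvp => ?_⟩
      · rw [hz, activeCount_cellCounts hmono h hle] at hspec
        have h1 := le_latestDecoded_of_le_ncard (keyOf := keyOf) hG h₀ hc (by gcongr) hspec
        exact h1.trans (latestDecoded_mono h₀ ht1)
      · rcases Nat.lt_or_ge v p with hv | hv
        · exact not_le.1 (hmax (v + 1) (by omega) (by omega))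
        · exact (activeCount_mono (by omega) le_rfl).trans_lt hself
    · refine ⟨0, Nat.zero_le _, by simp [h0], fun v _ hvp => ?_⟩
      rcases Nat.lt_or_ge v p with hv | hv
      · exact not_le.1 fun hle => hex ⟨v + 1, hv, hle⟩
      · exact (activeCount_mono (by omega) le_rfl).trans_lt hself
  calc versionAge G k keyOf c₀ c j t ≤ c₀ ((p + 1 : ℕ) * h) - c₀ (u * h) := by
        have h1 : c₀ t ≤ c₀ ((p + 1 : ℕ) * h) := h₀ (by exact_mod_cast ht2)
        exact sub_le_sub (by exact_mod_cast h1) (by exact_mod_cast hu1)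
    _ = ∑ v ∈ Finset.Ico u (p + 1), (z (none, v) : ℝ) :=
        (sum_Ico_cellCounts h₀ h (by omega)).symm
    _ = ∑ v ∈ Finset.Ico u (p + 1), (z (none, v) : ℝ) * fewActive k (v + 1) p z := by
        refine Finset.sum_congr rfl fun v hv => ?_
        have hv := Finset.mem_Ico.1 hv
        rw [fewActive, if_pos (hu2 v hv.1 (by omega)), mul_one]
    _ ≤ _ := by
        refine Finset.sum_le_sum_of_subset_of_nonneg (fun v hv => ?_) fun _ _ _ =>
          mul_nonneg (Nat.cast_nonneg _) (fewActive_nonneg _ _ _ _)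
        exact Finset.mem_range.2 (Finset.mem_Ico.1 hv).2

/-- With `d = 0` all activations from the start of the update's cell to the end of cell `p` are
counted, which underestimates pending updates; those of the current cell are discarded. The first
cell `u` still pending marks a version beyond which nothing is decoded. -/
lemma le_versionAge (h₀ : Monotone c₀) (hc : ∀ i ∈ inNeighbors G j, Monotone (c i j)) (h : ℝ≥0)
    (p : ℕ) {t : ℝ≥0} (ht1 : p * h ≤ t) (ht2 : t ≤ (p + 1) * h) :
    pendingOn k 0 (Finset.range (p + 1)) (p + 1) (cellCounts G c₀ c j h) -
      cellCounts G c₀ c j h (none, p) ≤ versionAge G k keyOf c₀ c j t := by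
  have : Fintype (inNeighbors G j) := Fintype.ofFinite _
  set z := cellCounts G c₀ c j h with hz
  have h1 : pendingOn k 0 (Finset.range (p + 1)) (p + 1) z - z (none, p) ≤
      ∑ u ∈ Finset.range p, (z (none, u) : ℝ) * fewActive k u (p + 1) z := by
    simp only [pendingOn, Finset.sum_range_succ _ p, add_zero]
    have := mul_le_of_le_one_right (Nat.cast_nonneg (α := ℝ) (z (none, p)))
      (fewActive_le_one k p (p + 1) z)
    linarith
  refine h1.trans ?_
  by_cases hex : ∃ u < p, activeCount z u (p + 1) < k
  · classical
    have hspec := Nat.find_spec hex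
    have hmin := fun v => Nat.find_min hex (m := v)
    set u := Nat.find hex
    calc _ ≤ ∑ v ∈ Finset.Ico u p, (z (none, v) : ℝ) * fewActive k v (p + 1) z := by
          refine (Finset.sum_subset (fun v hv => Finset.mem_range.2 (Finset.mem_Ico.1 hv).2)
            fun v hv hv' => ?_).symm.le
          have hv := Finset.mem_range.1 hv
          have hvu : v < u := by
            by_contra hge
            exact hv' (Finset.mem_Ico.2 ⟨not_lt.1 hge, hv⟩)
          have hno : ¬ activeCount z v (p + 1) < k := fun hlt => hmin v hvu ⟨hv, hlt⟩
          rw [fewActive, if_neg hno, mul_zero]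
      _ ≤ ∑ v ∈ Finset.Ico u p, (z (none, v) : ℝ) := Finset.sum_le_sum fun v _ =>
          mul_le_of_le_one_right (Nat.cast_nonneg _) (fewActive_le_one _ _ _ _)
      _ = c₀ (p * h) - c₀ (u * h) := sum_Ico_cellCounts h₀ h hspec.1.le
      _ ≤ _ := by
          have hlt := hspec.2
          rw [hz, activeCount_cellCounts hc h (by omega)] at hlt
          have h2 := latestDecoded_le_of_ncard_lt (keyOf := keyOf) h₀ hc hlt
          have h3 : latestDecoded G k keyOf c₀ c j t ≤ c₀ (u * h) :=
            (latestDecoded_mono h₀ (by exact_mod_cast ht2)).trans h2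
          exact sub_le_sub (by exact_mod_cast h₀ ht1) (by exact_mod_cast h3)
  · refine le_trans (Finset.sum_nonpos fun u hu => ?_) (versionAge_nonneg h₀ t)
    have hno : ¬ activeCount z u (p + 1) < k := fun hlt => hex ⟨u, Finset.mem_range.1 hu, hlt⟩
    rw [fewActive, if_neg hno, mul_zero]

end Pathwise

/-! ### From grid averages to continuous time averages -/

section TimeAverage

lemma tendsto_average_integral_of_nat {A : ℝ → ℝ} (hA : ∀ t, 0 ≤ A t)
    (hint : ∀ a b, IntervalIntegrable A volume a b) {L : ℝ}
    (h : Tendsto (fun n : ℕ => (∫ s in (0 : ℝ)..n, A s) / n) atTop (𝓝 L)) :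
    Tendsto (fun t : ℝ => (1 / t) * ∫ s in (0 : ℝ)..t, A s) atTop (𝓝 L) := by
  set I : ℝ → ℝ := fun t => ∫ s in (0 : ℝ)..t, A s with hI
  have hmono : Monotone I := fun s t hst => by
    have h1 := intervalIntegral.integral_add_adjacent_intervals (hint 0 s) (hint s t)
    have h2 := intervalIntegral.integral_nonneg (μ := volume) hst fun u _ => hA u
    simp only [hI]
    linarith
  have hlow : Tendsto (fun t : ℝ => (I ⌊t⌋₊ / ⌊t⌋₊) * ((⌊t⌋₊ : ℝ) / t)) atTop (𝓝 (L * 1)) :=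
    (h.comp tendsto_nat_floor_atTop).mul tendsto_nat_floor_div_atTop
  have hup : Tendsto (fun t : ℝ => (I ⌈t⌉₊ / ⌈t⌉₊) * ((⌈t⌉₊ : ℝ) / t)) atTop (𝓝 (L * 1)) :=
    (h.comp tendsto_nat_ceil_atTop).mul tendsto_nat_ceil_div_atTop
  rw [mul_one] at hlow hup
  refine tendsto_of_tendsto_of_tendsto_of_le_of_le' hlow hup ?_ ?_
  · filter_upwards [eventually_ge_atTop (1 : ℝ)] with t ht
    have h1 : (0 : ℝ) < ⌊t⌋₊ := by exact_mod_cast Nat.floor_pos.2 ht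
    have h2 : I ⌊t⌋₊ ≤ I t := hmono (Nat.floor_le (by linarith))
    rw [div_mul_div_cancel₀ h1.ne', div_mul_eq_mul_div, one_mul]
    exact div_le_div_of_nonneg_right h2 (by linarith)
  · filter_upwards [eventually_ge_atTop (1 : ℝ)] with t ht
    have h1 : (0 : ℝ) < ⌈t⌉₊ := by exact_mod_cast Nat.ceil_pos.2 (by linarith)
    have h2 : I t ≤ I ⌈t⌉₊ := hmono (Nat.le_ceil t)
    rw [div_mul_div_cancel₀ h1.ne', div_mul_eq_mul_div, one_mul]
    exact div_le_div_of_nonneg_right h2 (by linarith)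

lemma integral_grid_bounds {A : ℝ → ℝ} (hint : ∀ a b, IntervalIntegrable A volume a b) {q : ℕ}
    (hq : 0 < q) {lo up : ℕ → ℝ}
    (hbd : ∀ (p : ℕ) (t : ℝ), p / q ≤ t → t ≤ (p + 1) / q → lo p ≤ A t ∧ A t ≤ up p) (n : ℕ) :
    (∑ p ∈ Finset.range n, lo p) / q ≤ ∫ s in (0 : ℝ)..(n / q), A s ∧
      ∫ s in (0 : ℝ)..(n / q), A s ≤ (∑ p ∈ Finset.range n, up p) / q := by
  have hq' : (0 : ℝ) < q := by exact_mod_cast hq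
  have hsum : ∫ s in (0 : ℝ)..(n / q), A s =
      ∑ p ∈ Finset.range n, ∫ s in ((p : ℝ) / q)..((p + 1 : ℕ) / q), A s := by
    have := intervalIntegral.sum_integral_adjacent_intervals (f := A) (μ := volume)
      (a := fun p : ℕ => (p : ℝ) / q) (n := n) fun p _ => hint _ _
    rw [this]
    simp
  have hlen : ∀ (p : ℕ) (x : ℝ), ∫ _ in ((p : ℝ) / q)..((p + 1 : ℕ) / q), x = x / q := by
    intro p x
    rw [intervalIntegral.integral_const, smul_eq_mul]
    push_cast
    field_simp
    ring
  have hle : ∀ p : ℕ, (p : ℝ) / q ≤ (p + 1 : ℕ) / q := fun p => by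
    gcongr
    simp
  rw [hsum, Finset.sum_div, Finset.sum_div]
  constructor
  · refine Finset.sum_le_sum fun p _ => ?_
    rw [← hlen p]
    exact intervalIntegral.integral_mono_on (hle p) intervalIntegrable_const (hint _ _)
      fun t ht => (hbd p t ht.1 (by simpa using ht.2)).1
  · refine Finset.sum_le_sum fun p _ => ?_
    rw [← hlen p (up p)]
    exact intervalIntegral.integral_mono_on (hle p) (hint _ _) intervalIntegrable_const
      fun t ht => (hbd p t ht.1 (by simpa using ht.2)).2

/-- A path has the time average `L` if it is sandwiched, on arbitrarily fine grids, between step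
functions whose averages are close to `L`. -/
theorem tendsto_average_integral_of_grid {A : ℝ → ℝ} (hA : ∀ t, 0 ≤ A t)
    (hint : ∀ a b, IntervalIntegrable A volume a b) {L κ : ℝ}
    (hbd : ∀ q : ℕ, 0 < q → ∃ (lo up : ℕ → ℝ) (lo' up' : ℝ),
      Tendsto (fun n : ℕ => (∑ p ∈ Finset.range n, lo p) / n) atTop (𝓝 lo') ∧
      Tendsto (fun n : ℕ => (∑ p ∈ Finset.range n, up p) / n) atTop (𝓝 up') ∧
      (∀ (p : ℕ) (t : ℝ), p / q ≤ t → t ≤ (p + 1) / q → lo p ≤ A t ∧ A t ≤ up p) ∧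
      L - κ / q ≤ lo' ∧ up' ≤ L + κ / q) :
    Tendsto (fun t : ℝ => (1 / t) * ∫ s in (0 : ℝ)..t, A s) atTop (𝓝 L) := by
  refine tendsto_average_integral_of_nat hA hint ?_
  refine tendsto_order.2 ⟨fun x hx => ?_, fun x hx => ?_⟩
  · obtain ⟨q, hq0, hq⟩ : ∃ q : ℕ, 0 < q ∧ x < L - κ / q := by
      have h1 : Tendsto (fun q : ℕ => L - κ / q) atTop (𝓝 (L - 0)) :=
        tendsto_const_nhds.sub (tendsto_const_div_atTop_nhds_zero_nat κ)
      rw [sub_zero] at h1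
      exact ((eventually_gt_atTop 0).and (h1.eventually_const_lt hx)).exists
    obtain ⟨lo, up, lo', up', hlo, -, hb, hle, -⟩ := hbd q hq0
    -- After `n * q` cells of length `1 / q` the elapsed time is the integer `n`.
    have hmul : Tendsto (fun n : ℕ => n * q) atTop atTop :=
      tendsto_id.atTop_mul_const' hq0
    filter_upwards [(hlo.comp hmul).eventually_const_lt (hq.trans_le hle),
      eventually_gt_atTop 0] with n hn hn0
    refine hn.trans_le ?_
    have h2 := (integral_grid_bounds hint hq0 hb (n * q)).1
    have hq' : (q : ℝ) ≠ 0 := by exact_mod_cast hq0.ne'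
    simp only [Function.comp_apply]
    push_cast at h2 ⊢
    rw [mul_div_cancel_right₀ _ hq'] at h2
    rw [mul_comm (n : ℝ), ← div_div]
    gcongr
  · obtain ⟨q, hq0, hq⟩ : ∃ q : ℕ, 0 < q ∧ L + κ / q < x := by
      have h1 : Tendsto (fun q : ℕ => L + κ / q) atTop (𝓝 (L + 0)) :=
        tendsto_const_nhds.add (tendsto_const_div_atTop_nhds_zero_nat κ)
      rw [add_zero] at h1
      exact ((eventually_gt_atTop 0).and (h1.eventually_lt_const hx)).exists
    obtain ⟨lo, up, lo', up', -, hup, hb, -, hle⟩ := hbd q hq0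
    have hmul : Tendsto (fun n : ℕ => n * q) atTop atTop :=
      tendsto_id.atTop_mul_const' hq0
    filter_upwards [(hup.comp hmul).eventually_lt_const (hle.trans_lt hq),
      eventually_gt_atTop 0] with n hn hn0
    refine lt_of_le_of_lt ?_ hn
    have h2 := (integral_grid_bounds hint hq0 hb (n * q)).2
    have hq' : (q : ℝ) ≠ 0 := by exact_mod_cast hq0.ne'
    simp only [Function.comp_apply]
    push_cast at h2 ⊢
    rw [mul_div_cancel_right₀ _ hq'] at h2
    rw [mul_comm (n : ℝ), ← div_div]
    gcongr

end TimeAverage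

/-! ### Order statistics -/

section OrderStat

variable {ι : Type*} {s : Set ι} {k : ℕ}

/-- The infimum is attained: among finitely many values none lies just to the right of it, so the
count there is already the count at the infimum. -/
lemma orderStat_le_iff (hs : s.Finite) (hk : 1 ≤ k) (hks : k ≤ s.ncard) {Y : ι → ℝ} {x : ℝ} :
    orderStat s k Y ≤ x ↔ k ≤ {i ∈ s | Y i ≤ x}.ncard := by
  have hmono : ∀ {x y : ℝ}, x ≤ y → {i ∈ s | Y i ≤ x}.ncard ≤ {i ∈ s | Y i ≤ y}.ncard :=
    fun hxy => Set.ncard_le_ncard (fun i hi => ⟨hi.1, hi.2.trans hxy⟩) (hs.subset fun i hi => hi.1)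
  set A : Set ℝ := {x | k ≤ {i ∈ s | Y i ≤ x}.ncard} with hA
  have hbdd : BddBelow A := by
    obtain ⟨b, hb⟩ := (hs.image Y).bddBelow
    refine ⟨b, fun x hx => ?_⟩
    have hx : k ≤ {i ∈ s | Y i ≤ x}.ncard := hx
    obtain ⟨i, hi⟩ := Set.nonempty_of_ncard_ne_zero (show {i ∈ s | Y i ≤ x}.ncard ≠ 0 by omega)
    exact (hb ⟨i, hi.1, rfl⟩).trans hi.2
  have hne : A.Nonempty := by
    obtain ⟨b, hb⟩ := (hs.image Y).bddAbove
    refine ⟨b, ?_⟩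
    have : {i ∈ s | Y i ≤ b} = s := Set.Subset.antisymm (fun i hi => hi.1)
      fun i hi => ⟨hi, hb ⟨i, hi, rfl⟩⟩
    change k ≤ {i ∈ s | Y i ≤ b}.ncard
    rwa [this]
  refine ⟨fun h => ?_, fun h => csInf_le hbdd h⟩
  refine le_trans ?_ (hmono h)
  have hev : ∀ᶠ y in 𝓝[>] (orderStat s k Y), ∀ i ∈ s, Y i ≤ y → Y i ≤ orderStat s k Y := by
    rw [hs.eventually_all]
    intro i _
    by_cases hi : Y i ≤ orderStat s k Y
    · exact Eventually.of_forall fun _ _ => hi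
    · filter_upwards [Ioo_mem_nhdsGT (not_le.1 hi)] with y hy h'
      exact absurd h' (not_le.2 hy.2)
  obtain ⟨y, hy, hlt⟩ := (hev.and self_mem_nhdsWithin).exists
  obtain ⟨a, ha, hay⟩ := exists_lt_of_csInf_lt hne hlt
  have ha : k ≤ {i ∈ s | Y i ≤ a}.ncard := ha
  exact (ha.trans (hmono hay.le)).trans (Set.ncard_le_ncard (fun i hi => ⟨hi.1, hy i hi.1 hi.2⟩)
    (hs.subset fun i hi => hi.1))

lemma orderStat_congr {Y Y' : ι → ℝ} (h : ∀ i ∈ s, Y i = Y' i) :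
    orderStat s k Y = orderStat s k Y' := by
  have : ∀ x, {i ∈ s | Y i ≤ x} = {i ∈ s | Y' i ≤ x} := fun x => by
    ext i
    exact and_congr_right fun hi => by rw [h i hi]
  simp only [orderStat, this]

lemma orderStat_nonneg (hs : s.Finite) (hk : 1 ≤ k) (hks : k ≤ s.ncard) {Y : ι → ℝ}
    (hY : ∀ i ∈ s, 0 ≤ Y i) : 0 ≤ orderStat s k Y := by
  have h1 := (orderStat_le_iff hs hk hks (Y := Y)).1 le_rfl
  obtain ⟨i, hi, hle⟩ := Set.nonempty_of_ncard_ne_zero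
    (show {i ∈ s | Y i ≤ orderStat s k Y}.ncard ≠ 0 by omega)
  exact (hY i hi).trans hle

lemma exists_lt_of_lt_orderStat (hs : s.Finite) (hk : 1 ≤ k) (hks : k ≤ s.ncard) {Y : ι → ℝ}
    {x : ℝ} (hx : x < orderStat s k Y) : ∃ i ∈ s, x < Y i := by
  by_contra! hno
  refine absurd ((orderStat_le_iff hs hk hks).2 ?_) (not_le.2 hx)
  have : {i ∈ s | Y i ≤ x} = s := Set.Subset.antisymm (fun i hi => hi.1) fun i hi => ⟨hi, hno i hi⟩
  rwa [this]

lemma orderStat_le_sum (hs : s.Finite) (hk : 1 ≤ k) (hks : k ≤ s.ncard) {Y : ι → ℝ}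
    (hY : ∀ i ∈ s, 0 ≤ Y i) : orderStat s k Y ≤ ∑ i ∈ hs.toFinset, Y i := by
  by_contra! hlt
  obtain ⟨i, hi, h⟩ := exists_lt_of_lt_orderStat hs hk hks hlt
  exact absurd (Finset.single_le_sum (f := Y) (fun i hi => hY i (hs.mem_toFinset.1 hi))
    (hs.mem_toFinset.2 hi)) (not_le.2 h)

lemma measurable_orderStat {Ω : Type*} [MeasurableSpace Ω] (hs : s.Finite) (hk : 1 ≤ k)
    (hks : k ≤ s.ncard) {Y : ι → Ω → ℝ} (hY : ∀ i, Measurable (Y i)) :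
    Measurable fun ω => orderStat s k fun i => Y i ω := by
  refine measurable_of_Iic fun x => ?_
  -- The event is a finite union over the subsets of at least `k` indices whose values are all at
  -- most `x`.
  have : (fun ω => orderStat s k fun i => Y i ω) ⁻¹' Set.Iic x =
      ⋃ t ∈ hs.toFinset.powerset.filter (fun t => k ≤ t.card), ⋂ i ∈ t, {ω | Y i ω ≤ x} := by
    ext ω
    simp only [Set.mem_preimage, Set.mem_Iic, orderStat_le_iff hs hk hks, Set.mem_iUnion,
      Set.mem_iInter, Finset.mem_filter, Finset.mem_powerset]
    have hfin : {i ∈ s | Y i ω ≤ x}.Finite := hs.subset fun i hi => hi.1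
    constructor
    · intro h
      refine ⟨hfin.toFinset, ⟨fun i hi => ?_, ?_⟩, fun i hi => (hfin.mem_toFinset.1 hi).2⟩
      · exact hs.mem_toFinset.2 (hfin.mem_toFinset.1 hi).1
      · rwa [← Set.ncard_eq_toFinset_card _ hfin]
    · rintro ⟨t, ⟨hts, htk⟩, ht⟩
      refine htk.trans ?_
      rw [← Set.ncard_coe_finset]
      exact Set.ncard_le_ncard (fun i hi => ⟨hs.mem_toFinset.1 (hts hi), ht i hi⟩) hfin
  rw [this]
  exact Finset.measurableSet_biUnion _ fun t _ => Finset.measurableSet_biInter _ fun i _ =>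
    measurableSet_le (hY i) measurable_const

end OrderStat

/-! ### Interarrival times compared with activations in a window -/

section Comparison

variable {ι Ω : Type*} [Fintype ι] [MeasurableSpace Ω] {P : Measure Ω} [IsProbabilityMeasure P]

lemma identDistrib_prop {p q : Ω → Prop} (hp : Measurable p) (hq : Measurable q)
    (h : P {ω | p ω} = P {ω | q ω}) : IdentDistrib p q P P := by
  refine ⟨hp.aemeasurable, hq.aemeasurable, ?_⟩
  have hc : P {ω | ¬ p ω} = P {ω | ¬ q ω} := by
    have h1 := prob_compl_eq_one_sub (μ := P) (measurableSet_setOfPred.2 hp)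
    have h2 := prob_compl_eq_one_sub (μ := P) (measurableSet_setOfPred.2 hq)
    exact h1.trans ((congrArg (1 - ·) h).trans h2.symm)
  refine Measure.ext_of_singleton fun x => ?_
  rw [Measure.map_apply hp .of_discrete, Measure.map_apply hq .of_discrete]
  by_cases hx : x
  · simpa [hx, Set.preimage] using h
  · simpa [hx, Set.preimage] using hc

/-- The number of occurring events among independent ones depends in law on the probabilities
only. -/
lemma measureReal_ncard_lt_congr {A B : ι → Ω → Prop} (hA : ∀ i, Measurable (A i))
    (hB : ∀ i, Measurable (B i)) (hAi : iIndepFun A P) (hBi : iIndepFun B P)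
    (h : ∀ i, P {ω | A i ω} = P {ω | B i ω}) (k : ℕ) :
    P.real {ω | {i | A i ω}.ncard < k} = P.real {ω | {i | B i ω}.ncard < k} := by
  have h1 := IdentDistrib.pi (fun i => identDistrib_prop (hA i) (hB i) (h i)) hAi hBi
  have h2 := h1.measure_mem_eq (s := {x : ι → Prop | {i | x i}.ncard < k})
    (Set.toFinite _).measurableSet
  exact congrArg ENNReal.toReal h2

variable {M : ι → ℝ≥0 → Ω → ℕ} {lam : ι → ℝ≥0}

/-- The number of edges activated in `(s, t]` is distributed as the number of edges with an
interarrival time of length at most `t - s`. -/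
lemma measureReal_ncard_interarrival (hM : ∀ i, IsPoissonCounter (M i) (lam i) P)
    (hlam : ∀ i, 0 < lam i) (hind : iIndepFun (fun i ω t => M i t ω) P) (r : ι → ℕ) (k : ℕ)
    {s t : ℝ≥0} (hst : s ≤ t) :
    P.real {ω | {i | interarrival (fun t => M i t ω) (r i) ≤ (t - s : ℝ≥0)}.ncard < k} =
      P.real {ω | {i | M i s ω < M i t ω}.ncard < k} := by
  set A : ι → Ω → Prop := fun i ω => countableEventTime (r i + 1) (fun t => M i t ω) -
    countableEventTime (r i) (fun t => M i t ω) ≤ (t - s : ℝ≥0)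
  set B : ι → Ω → Prop := fun i ω => M i s ω < M i t ω
  have hA' : ∀ i, Measurable fun c : ℝ≥0 → ℕ =>
      (countableEventTime (r i + 1) c - countableEventTime (r i) c ≤ (t - s : ℝ≥0) : Prop) :=
    fun i => measurableSet_setOfPred.1 (measurableSet_le ((measurable_countableEventTime _).sub
      (measurable_countableEventTime _)) measurable_const)
  have hB' : Measurable fun c : ℝ≥0 → ℕ => (c s < c t : Prop) :=
    measurableSet_setOfPred.1 (measurableSet_lt (measurable_pi_apply _) (measurable_pi_apply _))
  have hA : ∀ i, Measurable (A i) := fun i => (hA' i).comp (hM i).measurable_path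
  have hB : ∀ i, Measurable (B i) := fun i => hB'.comp (hM i).measurable_path
  -- Both complements have probability `exp (-(lam i * (t - s)))`: one is the exponential tail, the
  -- other the Poisson weight at `0`.
  have hAB : ∀ i, P {ω | A i ω} = P {ω | B i ω} := by
    intro i
    have h1 : P {ω | ¬ A i ω} = ENNReal.ofReal (Real.exp (-(lam i * (t - s : ℝ≥0)))) := by
      rw [← (hM i).measureReal_lt_interarrival (hlam i) (r i) (NNReal.coe_nonneg (t - s)),
        ofReal_measureReal]
      refine measure_congr ?_
      filter_upwards [(hM i).ae_isRegularPath (hlam i)] with ω hω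
      have := hω.interarrival_eq (r i)
      change (¬ A i ω) = (((t - s : ℝ≥0) : ℝ) < interarrival (fun t => M i t ω) (r i))
      rw [this, eq_iff_iff, not_le]
    have h2 : P {ω | ¬ B i ω} = ENNReal.ofReal (Real.exp (-(lam i * (t - s : ℝ≥0)))) := by
      have h3 := ((hM i).increment_law s t hst).measure_eq (p := fun n => n = 0) .of_discrete
      have h4 : {n : ℕ | n = 0} = {0} := rfl
      rw [h4, poissonMeasure_singleton] at h3
      simp only [pow_zero, Nat.factorial_zero, Nat.cast_one, mul_one, div_one, NNReal.coe_mul] at h3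
      rw [← h3]
      congr 1
      ext ω
      change ¬ (M i s ω < M i t ω) ↔ M i t ω - M i s ω = 0
      omega
    have h5 := prob_compl_eq_one_sub (μ := P) (measurableSet_setOfPred.2 (hA i)).compl
    have h6 := prob_compl_eq_one_sub (μ := P) (measurableSet_setOfPred.2 (hB i)).compl
    rw [compl_compl] at h5 h6
    exact h5.trans ((congrArg (1 - ·) (h1.trans h2.symm)).trans h6.symm)
  rw [← measureReal_ncard_lt_congr hA hB (hind.comp _ hA') (hind.comp _ fun _ => hB') hAB k]
  refine measureReal_congr ?_
  filter_upwards [ae_all_iff.2 fun i => (hM i).ae_isRegularPath (hlam i)] with ω hω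
  change (_ < k) = (_ < k)
  congr 2
  ext i
  change interarrival (fun t => M i t ω) (r i) ≤ (t - s : ℝ≥0) ↔ A i ω
  rw [(hω i).interarrival_eq]

end Comparison

/-! ### Expectations and sums of tail probabilities -/

section TailSum

variable {Ω : Type*} [MeasurableSpace Ω] {P : Measure Ω} [IsProbabilityMeasure P]

/-- The expectation of a nonnegative random variable is comparable to the sum of its tail
probabilities on a grid of mesh `h`. -/
lemma integral_tail_bounds {T : Ω → ℝ} (hT : Integrable T P) (hnn : 0 ≤ᵐ[P] T) {h : ℝ}
    (hh : 0 < h) (hsum : Summable fun m : ℕ => P.real {ω | m * h < T ω}) :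
    h * ∑' m : ℕ, P.real {ω | ((m + 1 : ℕ) : ℝ) * h < T ω} ≤ ∫ ω, T ω ∂P ∧
      ∫ ω, T ω ∂P ≤ h * ∑' m : ℕ, P.real {ω | (m : ℝ) * h < T ω} := by
  set g : ℝ → ℝ := fun x => P.real {ω | x * h < T ω} with hg
  have hanti : Antitone g := fun x y hxy => measureReal_mono fun ω hω =>
    lt_of_le_of_lt (mul_le_mul_of_nonneg_right hxy hh.le) hω
  have hgnn : ∀ x, 0 ≤ g x := fun x => measureReal_nonneg
  have hsum' : Summable fun m : ℕ => g m := hsum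
  have hE : ∫ ω, T ω ∂P = h * ∫ x in Set.Ioi 0, g x := by
    have h1 := (hT.div_const h).integral_eq_integral_meas_lt (by
      filter_upwards [hnn] with ω hω using div_nonneg hω hh.le)
    rw [integral_div] at h1
    rw [div_eq_iff hh.ne'] at h1
    rw [h1, mul_comm]
    congr 2
    ext x
    simp only [hg, lt_div_iff₀ hh]
  have hgint : ∀ a b, IntervalIntegrable g volume a b := fun a b => hanti.intervalIntegrable
  -- Integral test for the decreasing rescaled tail; the same comparison of sums and integrals gives
  -- both bounds.
  have hgi : IntegrableOn g (Set.Ioi 0) := by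
    refine integrableOn_Ioi_of_intervalIntegral_norm_bounded (ι := ℕ) (l := atTop)
      (b := fun n : ℕ => (n : ℝ)) (∑' m : ℕ, g m) 0 (fun n => (hgint 0 n).1)
      tendsto_natCast_atTop_atTop (Eventually.of_forall fun n => ?_)
    have h1 := AntitoneOn.integral_le_sum (f := g) (x₀ := 0) (a := n) (hanti.antitoneOn _)
    simp only [zero_add] at h1
    simp only [Real.norm_of_nonneg (hgnn _)]
    exact h1.trans (hsum'.sum_le_tsum _ fun _ _ => hgnn _)
  have hlim : Tendsto (fun n : ℕ => ∫ x in (0 : ℝ)..n, g x) atTop (𝓝 (∫ x in Set.Ioi 0, g x)) :=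
    intervalIntegral_tendsto_integral_Ioi 0 hgi tendsto_natCast_atTop_atTop
  rw [hE]
  change h * ∑' m : ℕ, g (m + 1 : ℕ) ≤ _ ∧ _ ≤ h * ∑' m : ℕ, g m
  clear_value g
  constructor
  · refine mul_le_mul_of_nonneg_left ?_ hh.le
    have hs' : Summable fun m : ℕ => g (m + 1 : ℕ) := (summable_nat_add_iff (f := fun m : ℕ => g m) 1).2 hsum'
    refine le_of_tendsto_of_tendsto' hs'.hasSum.tendsto_sum_nat hlim fun n => ?_
    have h1 := AntitoneOn.sum_le_integral (f := g) (x₀ := 0) (a := n) (hanti.antitoneOn _)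
    simpa using h1
  · refine mul_le_mul_of_nonneg_left ?_ hh.le
    refine le_of_tendsto_of_tendsto' hlim hsum'.hasSum.tendsto_sum_nat fun n => ?_
    have h1 := AntitoneOn.integral_le_sum (f := g) (x₀ := 0) (a := n) (hanti.antitoneOn _)
    simpa using h1

end TailSum

lemma IsTSSFeasible.le_ncard_inNeighbors {V : Type*} [Finite V] {G : Digraph (Option V)} {k : ℕ}
    (hG : IsTSSFeasible G k) (j : V) : k ≤ (inNeighbors G j).ncard := by
  have h1 : {v | G.Adj v (some j)} ⊆ insert none (some '' inNeighbors G j) := by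
    rintro (_ | i) hi
    · exact Or.inl rfl
    · exact Or.inr ⟨i, hi, rfl⟩
  have h2 := Set.ncard_le_ncard h1 (Set.toFinite _)
  have h3 := Set.ncard_insert_le none (some '' inNeighbors G j)
  rw [Set.ncard_image_of_injective _ (Option.some_injective V)] at h3
  have := hG.lt_inDegree j
  omega

/-! ### The gossip process on the grid -/

namespace IsGossipProcess

variable {V Ω : Type*} [MeasurableSpace Ω] {P : Measure Ω} {G : Digraph (Option V)}
  {lamS : ℝ≥0} {lamE : V → V → ℝ≥0} {N₀ : ℝ≥0 → Ω → ℕ} {N : V → V → ℝ≥0 → Ω → ℕ} {j : V}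

/-- The counter of the source (index `none`) or of an edge towards `j`. -/
def counter (N₀ : ℝ≥0 → Ω → ℕ) (N : V → V → ℝ≥0 → Ω → ℕ) (j : V) :
    Option (inNeighbors G j) → ℝ≥0 → Ω → ℕ
  | none => N₀
  | some i => N i j

lemma iIndepFun_counter (hN : IsGossipProcess G lamS lamE N₀ N P) :
    iIndepFun (fun (o : Option (inNeighbors G j)) ω t => counter N₀ N j o t ω) P := by
  have hinj : Function.Injective (Option.map fun i : inNeighbors G j =>
      (⟨(i.1, j), i.2⟩ : Edge G)) := by
    refine Option.map_injective fun i i' h => ?_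
    have := congrArg (fun e : Edge G => e.1.1) h
    exact Subtype.ext this
  have h := hN.indep.precomp hinj
  convert! h using 2 with o
  rcases o with _ | i <;> rfl

lemma exists_isPoissonCounter (hN : IsGossipProcess G lamS lamE N₀ N P)
    (o : Option (inNeighbors G j)) : ∃ r, IsPoissonCounter (counter N₀ N j o) r P := by
  rcases o with _ | i
  · exact ⟨_, hN.source⟩
  · exact ⟨_, hN.edge i j i.2⟩

lemma iIndepFun_edges (hN : IsGossipProcess G lamS lamE N₀ N P) :
    iIndepFun (fun (i : inNeighbors G j) ω t => N i j t ω) P :=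
  hN.iIndepFun_counter.precomp (Option.some_injective _)

lemma measureReal_lt_orderStat [Finite V] [IsProbabilityMeasure P]
    (hN : IsGossipProcess G lamS lamE N₀ N P)
    (hlamE : ∀ i j, G.Adj (some i) (some j) → 0 < lamE i j) {k : ℕ} (hk : 1 ≤ k)
    (hkj : k ≤ (inNeighbors G j).ncard) (r : V → ℕ) {s t : ℝ≥0} (hst : s ≤ t) :
    P.real {ω | ((t - s : ℝ≥0) : ℝ) < orderStat (inNeighbors G j) k fun i =>
      interarrival (fun t => N i j t ω) (r i)} =
    P.real {ω | {i ∈ inNeighbors G j | N i j s ω < N i j t ω}.ncard < k} := by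
  have : Fintype (inNeighbors G j) := Fintype.ofFinite _
  have hsub : ∀ p : V → Prop,
      {i ∈ inNeighbors G j | p i}.ncard = {i : inNeighbors G j | p i}.ncard := by
    intro p
    rw [← Set.ncard_image_of_injective _ Subtype.val_injective]
    congr 1
    ext i
    simp [and_comm]
  have h1 := measureReal_ncard_interarrival (M := fun i : inNeighbors G j => N i j)
    (fun i => hN.edge i j i.2) (fun i => hlamE i j i.2) hN.iIndepFun_edges (fun i => r i) k hst
  have h2 : ∀ ω, ((t - s : ℝ≥0) : ℝ) < orderStat (inNeighbors G j) k (fun i =>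
      interarrival (fun t => N i j t ω) (r i)) ↔
      {i : inNeighbors G j | interarrival (fun t => N i j t ω) (r i) ≤ (t - s : ℝ≥0)}.ncard < k :=
    fun ω => by rw [← not_le, orderStat_le_iff (Set.toFinite _) hk hkj, not_le, hsub]
  simp only [hsub]
  rw [← h1]
  exact congrArg P.real (Set.ext h2)

lemma isGridModel [Finite V] [IsProbabilityMeasure P]
    (hN : IsGossipProcess G lamS lamE N₀ N P)
    (hlamE : ∀ i j, G.Adj (some i) (some j) → 0 < lamE i j) {k : ℕ} (hk : 1 ≤ k)
    (hkj : k ≤ (inNeighbors G j).ncard) (r : V → ℕ) (h : ℝ≥0) :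
    IsGridModel P (fun x ω => cellCounts G (fun t => N₀ t ω) (fun i i' t => N i i' t ω) j h x) k
      (lamS * h) fun m => P.real {ω | (m : ℝ) * h < orderStat (inNeighbors G j) k fun i =>
        interarrival (fun t => N i j t ω) (r i)} := by
  have hcell : ∀ (o : Option (inNeighbors G j)) (u : ℕ) ω,
      cellCounts G (fun t => N₀ t ω) (fun i i' t => N i i' t ω) j h (o, u) =
        counter N₀ N j o ((u + 1) * h) ω - counter N₀ N j o (u * h) ω := by
    rintro (_ | i) u ω <;> rfl
  have hcm : ∀ (o : Option (inNeighbors G j)) t, Measurable (counter N₀ N j o t) := by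
    intro o
    obtain ⟨_, hr⟩ := hN.exists_isPoissonCounter o
    exact hr.measurable
  have hmono : ∀ u : ℕ, (u : ℝ≥0) * h ≤ (u + 1) * h := fun u => by gcongr; simp
  refine ⟨?_, ?_, ?_, ?_⟩
  · rintro ⟨o, u⟩
    simp only [hcell]
    exact (hcm o _).sub (hcm o _)
  · simp only [hcell]
    -- Joint independence of all cells combines independence of the counters with independence of
    -- the increments of each one.
    refine iIndepFun_uncurry' (X := fun (o : Option (inNeighbors G j)) (u : ℕ) ω =>
      counter N₀ N j o ((u + 1) * h) ω - counter N₀ N j o (u * h) ω)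
      (fun o u => (hcm o _).sub (hcm o _)) ?_ fun o => ?_
    · exact hN.iIndepFun_counter.comp
        (fun _ (c : ℝ≥0 → ℕ) (u : ℕ) => c ((u + 1) * h) - c (u * h)) fun _ =>
          measurable_pi_lambda _ fun u => (measurable_pi_apply _).sub (measurable_pi_apply _)
    · obtain ⟨_, hr⟩ := hN.exists_isPoissonCounter o
      have := hr.indep_increments.nat (t := fun u : ℕ => (u : ℝ≥0) * h)
        (monotone_nat_of_le_succ fun u => by exact_mod_cast hmono u)
      simpa only [Nat.cast_succ] using this
  · intro u
    have := hN.source.increment_law (u * h) ((u + 1) * h) (hmono u)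
    rwa [show ((u : ℝ≥0) + 1) * h - u * h = h by rw [add_mul, one_mul, add_tsub_cancel_left]]
      at this
  · intro s e hse
    have h1 : ((s : ℝ≥0)) * h ≤ e * h := by gcongr
    have h2 := hN.measureReal_lt_orderStat hlamE hk hkj r h1
    have h3 : (((e : ℝ≥0) * h - s * h : ℝ≥0) : ℝ) = ((e - s : ℕ) : ℝ) * h := by
      rw [NNReal.coe_sub h1, Nat.cast_sub hse]
      push_cast
      ring
    rw [h3] at h2
    rw [h2]
    refine measureReal_congr ?_
    have hm : ∀ᵐ ω ∂P, ∀ i : inNeighbors G j, Monotone fun t => N i j t ω := by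
      have : Countable (inNeighbors G j) := Finite.to_countable
      exact ae_all_iff.2 fun i => (hN.edge i j i.2).path_mono
    filter_upwards [hm] with ω hω
    change (_ < k) = (_ < k)
    rw [activeCount_cellCounts (fun i hi => hω ⟨i, hi⟩) h hse]

section OrderStat

variable [Finite V]

lemma ae_isRegularPath_edges (hN : IsGossipProcess G lamS lamE N₀ N P)
    (hlamE : ∀ i j, G.Adj (some i) (some j) → 0 < lamE i j) :
    ∀ᵐ ω ∂P, ∀ i ∈ inNeighbors G j, IsRegularPath fun t => N i j t ω := by
  have h : ∀ᵐ ω ∂P, ∀ i : inNeighbors G j, IsRegularPath fun t => N i j t ω := by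
    have : Countable (inNeighbors G j) := Finite.to_countable
    exact ae_all_iff.2 fun i => (hN.edge i j i.2).ae_isRegularPath (hlamE i j i.2)
  filter_upwards [h] with ω hω i hi using hω ⟨i, hi⟩

lemma integrable_orderStat (hN : IsGossipProcess G lamS lamE N₀ N P)
    (hlamE : ∀ i j, G.Adj (some i) (some j) → 0 < lamE i j) {k : ℕ} (hk : 1 ≤ k)
    (hkj : k ≤ (inNeighbors G j).ncard) (r : V → ℕ) :
    Integrable (fun ω => orderStat (inNeighbors G j) k fun i =>
      interarrival (fun t => N i j t ω) (r i)) P := by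
  classical
  have hfin : (inNeighbors G j).Finite := Set.toFinite _
  have hmeas : AEStronglyMeasurable (fun ω => orderStat (inNeighbors G j) k fun i =>
      interarrival (fun t => N i j t ω) (r i)) P := by
    refine (measurable_orderStat hfin hk hkj (Y := fun i ω => if i ∈ inNeighbors G j then
      countableEventTime (r i + 1) (fun t => N i j t ω) -
        countableEventTime (r i) (fun t => N i j t ω) else 0) fun i => ?_).aestronglyMeasurable.congr
      ?_
    · split_ifs with hi
      · have hp := (hN.edge i j hi).measurable_path
        exact ((measurable_countableEventTime _).comp hp).sub
          ((measurable_countableEventTime _).comp hp)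
      · exact measurable_const
    · filter_upwards [hN.ae_isRegularPath_edges hlamE] with ω hω
      refine orderStat_congr fun i hi => ?_
      rw [if_pos hi, (hω i hi).interarrival_eq]
  refine Integrable.mono' (g := fun ω => ∑ i ∈ hfin.toFinset,
    interarrival (fun t => N i j t ω) (r i)) (integrable_finsetSum _ fun i hi => ?_) hmeas ?_
  · have hi := hfin.mem_toFinset.1 hi
    exact (hN.edge i j hi).integrable_interarrival (hlamE i j hi) _
  · filter_upwards [hN.ae_isRegularPath_edges hlamE] with ω hω
    have hnn : ∀ i ∈ inNeighbors G j, 0 ≤ interarrival (fun t => N i j t ω) (r i) :=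
      fun i hi => (hω i hi).interarrival_nonneg _
    rw [Real.norm_of_nonneg (orderStat_nonneg hfin hk hkj hnn)]
    exact orderStat_le_sum hfin hk hkj hnn

/-- Union bound over the in-edges, each tail being dominated by that of the slowest edge. The square
root and the halved exponent put the bound into the squared form used for second moments. -/
lemma exists_tail_bound [IsProbabilityMeasure P] (hN : IsGossipProcess G lamS lamE N₀ N P)
    (hlamE : ∀ i j, G.Adj (some i) (some j) → 0 < lamE i j) {k : ℕ} (hk : 1 ≤ k)
    (hkj : k ≤ (inNeighbors G j).ncard) (r : V → ℕ) {h : ℝ} (hh : 0 < h) :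
    ∃ c ρ : ℝ, 0 ≤ c ∧ 0 ≤ ρ ∧ ρ < 1 ∧ ∀ m : ℕ,
      P.real {ω | (m : ℝ) * h < orderStat (inNeighbors G j) k fun i =>
        interarrival (fun t => N i j t ω) (r i)} ≤ (c * ρ ^ m) ^ 2 := by
  have hfin : (inNeighbors G j).Finite := Set.toFinite _
  obtain ⟨i₀, hi₀⟩ := Set.nonempty_of_ncard_ne_zero (show (inNeighbors G j).ncard ≠ 0 by omega)
  have hne : Nonempty (inNeighbors G j) := ⟨⟨i₀, hi₀⟩⟩
  obtain ⟨i₁, hi₁⟩ := Finite.exists_min fun i : inNeighbors G j => lamE i j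
  have hδ : (0 : ℝ) < lamE i₁ j := hlamE i₁ j i₁.2
  refine ⟨Real.sqrt (inNeighbors G j).ncard, Real.exp (-(lamE i₁ j * h / 2)), Real.sqrt_nonneg _,
    Real.exp_nonneg _, by rw [Real.exp_lt_one_iff]; have := mul_pos hδ hh; linarith, fun m => ?_⟩
  calc _ ≤ P.real (⋃ i ∈ hfin.toFinset,
          {ω | (m : ℝ) * h < interarrival (fun t => N i j t ω) (r i)}) := by
        refine measureReal_mono (fun ω hω => ?_) (measure_ne_top _ _)
        obtain ⟨i, hi, hlt⟩ := exists_lt_of_lt_orderStat hfin hk hkj hω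
        exact Set.mem_biUnion (hfin.mem_toFinset.2 hi) hlt
    _ ≤ ∑ i ∈ hfin.toFinset,
          P.real {ω | (m : ℝ) * h < interarrival (fun t => N i j t ω) (r i)} :=
        measureReal_biUnion_finset_le _ _
    _ ≤ ∑ i ∈ hfin.toFinset, Real.exp (-(lamE i₁ j * (m * h))) := by
        refine Finset.sum_le_sum fun i hi => ?_
        have hi := hfin.mem_toFinset.1 hi
        rw [(hN.edge i j hi).measureReal_lt_interarrival (hlamE i j hi) _ (by positivity)]
        have h1 : (lamE i₁ j : ℝ) ≤ lamE i j := hi₁ ⟨i, hi⟩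
        gcongr
    _ = (Real.sqrt (inNeighbors G j).ncard * Real.exp (-(lamE i₁ j * h / 2)) ^ m) ^ 2 := by
        rw [mul_pow, Real.sq_sqrt (Nat.cast_nonneg _), ← pow_mul, ← Real.exp_nat_mul,
          Finset.sum_const, ← Set.ncard_eq_toFinset_card _ hfin, nsmul_eq_mul]
        congr 2
        push_cast
        ring

end OrderStat

/-- Almost surely, the version age is sandwiched on the grid of mesh `1 / q` between step functions
whose averages differ from `lamS` times the mean of the order statistic by at most `2 lamS / q`. -/
lemma ae_exists_grid_bounds [Finite V] [IsProbabilityMeasure P]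
    (hN : IsGossipProcess G lamS lamE N₀ N P)
    (hlamS : 0 < lamS) (hlamE : ∀ i j, G.Adj (some i) (some j) → 0 < lamE i j)
    {k n : ℕ} (hk : 1 ≤ k) (hG : IsTSSFeasible G k) (keyOf : ℕ → V ≃ Fin n) (r : V → ℕ)
    {q : ℕ} (hq : 0 < q) :
    ∀ᵐ ω ∂P, ∃ (lo up : ℕ → ℝ) (lo' up' : ℝ),
      Tendsto (fun n : ℕ => (∑ p ∈ Finset.range n, lo p) / n) atTop (𝓝 lo') ∧
      Tendsto (fun n : ℕ => (∑ p ∈ Finset.range n, up p) / n) atTop (𝓝 up') ∧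
      (∀ (p : ℕ) (t : ℝ), p / q ≤ t → t ≤ (p + 1) / q →
        lo p ≤ versionAge G k keyOf (fun t => N₀ t ω) (fun i i' t => N i i' t ω) j t.toNNReal ∧
        versionAge G k keyOf (fun t => N₀ t ω) (fun i i' t => N i i' t ω) j t.toNNReal ≤ up p) ∧
      lamS * (∫ ω', orderStat (inNeighbors G j) k (fun i =>
        interarrival (fun t => N i j t ω') (r i)) ∂P) - (2 * lamS : ℝ) / q ≤ lo' ∧
      up' ≤ lamS * (∫ ω', orderStat (inNeighbors G j) k (fun i =>
        interarrival (fun t => N i j t ω') (r i)) ∂P) + (2 * lamS : ℝ) / q := by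
  have : Fintype (inNeighbors G j) := Fintype.ofFinite _
  have hkj := hG.le_ncard_inNeighbors j
  have hq' : (0 : ℝ) < q := by exact_mod_cast hq
  set h : ℝ≥0 := (q : ℝ≥0)⁻¹ with hh
  have hhr : (h : ℝ) = (q : ℝ)⁻¹ := by simp [hh]
  have hhpos : (0 : ℝ) < h := by rw [hhr]; positivity
  set T : Ω → ℝ := fun ω => orderStat (inNeighbors G j) k fun i =>
    interarrival (fun t => N i j t ω) (r i) with hT
  set φ : ℕ → ℝ := fun m => P.real {ω | (m : ℝ) * h < T ω} with hφ
  have hgrid : IsGridModel P _ k (lamS * h) φ := hN.isGridModel hlamE hk hkj r h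
  obtain ⟨c, ρ, hc, hρ0, hρ1, hb⟩ := hN.exists_tail_bound hlamE hk hkj r hhpos
  have hφ0 : ∀ m, 0 ≤ φ m := fun m => measureReal_nonneg
  have hsum : Summable φ := by
    refine Summable.of_nonneg_of_le hφ0 hb ?_
    have : (fun m => (c * ρ ^ m) ^ 2) = fun m => c ^ 2 * (ρ ^ 2) ^ m := by
      ext m
      rw [mul_pow, ← pow_mul, ← pow_mul, mul_comm m]
    rw [this]
    exact (summable_geometric_of_lt_one (sq_nonneg _) (by nlinarith)).mul_left _
  have hTnn : 0 ≤ᵐ[P] T := by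
    filter_upwards [hN.ae_isRegularPath_edges hlamE] with ω hω
    exact orderStat_nonneg (Set.toFinite _) hk hkj fun i hi => (hω i hi).interarrival_nonneg _
  obtain ⟨hE1, hE2⟩ := integral_tail_bounds (hN.integrable_orderStat hlamE hk hkj r) hTnn hhpos hsum
  change (h : ℝ) * ∑' m : ℕ, φ (m + 1) ≤ ∫ ω, T ω ∂P at hE1
  change ∫ ω, T ω ∂P ≤ (h : ℝ) * ∑' m : ℕ, φ m at hE2
  have hshift : ∑' m, φ m = φ 0 + ∑' m, φ (m + 1) := hsum.tsum_eq_zero_add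
  have hφ01 : φ 0 ≤ 1 := measureReal_le_one
  filter_upwards [hgrid.ae_tendsto_average_pendingOn (d := 0) zero_le_one hc hρ0 hρ1 hφ0 hb,
    hgrid.ae_tendsto_average_pendingOn (d := 1) le_rfl hc hρ0 hρ1 hφ0 hb,
    hgrid.ae_tendsto_average_source, hN.source.ae_isRegularPath hlamS, hN.source.path_zero,
    hN.ae_isRegularPath_edges (j := j) hlamE] with ω hW0 hW1 hD hreg0 hzero hreg
  set z := cellCounts G (fun t => N₀ t ω) (fun i i' t => N i i' t ω) j h with hz
  simp only [Nat.sub_zero] at hW0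
  simp only [Nat.add_sub_cancel] at hW1
  set a : ℝ := ((lamS * h : ℝ≥0) : ℝ) with ha
  have haq : a = lamS * h := by simp [ha]
  refine ⟨fun p => pendingOn k 0 (Finset.range (p + 1)) (p + 1) z - z (none, p),
    fun p => z (none, p) + pendingOn k 1 (Finset.range p) p z,
    a * ∑' m, φ (m + 1) - a, a + a * ∑' m, φ m, ?_, ?_, fun p t ht1 ht2 => ?_, ?_, ?_⟩
  -- The lower step function is `pendingOn` shifted by one cell; the shift costs a factor `(n + 1) /
  -- n` and a vanishing initial term.
  · have h1 : Tendsto (fun n : ℕ => (∑ p ∈ Finset.range (n + 1),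
        pendingOn k 0 (Finset.range p) p z) / (n + 1 : ℕ) * (((n + 1 : ℕ) : ℝ) / n)) atTop
        (𝓝 ((a * ∑' m, φ (m + 1)) * 1)) := by
      refine (hW0.comp (tendsto_add_atTop_nat 1)).mul ?_
      have h2 : Tendsto (fun n : ℕ => 1 + 1 / (n : ℝ)) atTop (𝓝 (1 + 0)) :=
        tendsto_const_nhds.add tendsto_one_div_atTop_nhds_zero_nat
      rw [add_zero] at h2
      refine h2.congr' ?_
      filter_upwards [eventually_gt_atTop 0] with n hn
      have : (n : ℝ) ≠ 0 := by exact_mod_cast hn.ne'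
      push_cast
      field_simp
    rw [mul_one] at h1
    refine (h1.sub hD).congr' ?_
    filter_upwards [eventually_gt_atTop 0] with n hn
    have h2 : pendingOn k 0 (Finset.range 0) 0 z = 0 := by simp [pendingOn]
    rw [Finset.sum_sub_distrib, sub_div, div_mul_div_cancel₀ (by positivity),
      Finset.sum_range_succ', h2, add_zero]
  · refine (hD.add hW1).congr fun n => ?_
    rw [Finset.sum_add_distrib, add_div]
  · have ht0 : 0 ≤ t := le_trans (by positivity) ht1
    have ht1' : (p : ℝ≥0) * h ≤ t.toNNReal := by
      rw [← NNReal.coe_le_coe, Real.coe_toNNReal _ ht0]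
      push_cast
      rw [hhr, ← div_eq_mul_inv]
      exact ht1
    have ht2' : t.toNNReal ≤ ((p : ℝ≥0) + 1) * h := by
      rw [← NNReal.coe_le_coe, Real.coe_toNNReal _ ht0]
      push_cast
      rw [hhr, ← div_eq_mul_inv]
      exact ht2
    exact ⟨le_versionAge hreg0.mono (fun i hi => (hreg i hi).mono) h p ht1' ht2',
      versionAge_le hk hG.loopless hreg0.mono hzero hreg h p ht1' ht2'⟩
  -- One error `a = lamS / q` comes from the current cell, the other from the term `φ 0 ≤ 1` by
  -- which the two tail sums differ.
  · have h1 : (lamS : ℝ) * ∫ ω, T ω ∂P ≤ lamS * (h * ∑' m, φ m) := by gcongr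
    have h2 : a * φ 0 ≤ a * 1 := by gcongr
    have h3 : (2 * lamS : ℝ) / q = 2 * a := by rw [haq, hhr]; ring
    rw [h3]
    have h4 : (lamS : ℝ) * (h * ∑' m, φ m) = a * φ 0 + a * ∑' m, φ (m + 1) := by
      rw [hshift, haq]; ring
    linarith
  · have h1 : (lamS : ℝ) * (h * ∑' m, φ (m + 1)) ≤ lamS * ∫ ω, T ω ∂P := by gcongr
    have h2 : a * φ 0 ≤ a * 1 := by gcongr
    have h3 : (2 * lamS : ℝ) / q = 2 * a := by rw [haq, hhr]; ring
    rw [h3]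
    have h4 : a * ∑' m, φ m = a * φ 0 + lamS * (h * ∑' m, φ (m + 1)) := by
      rw [hshift, haq]; ring
    linarith

end IsGossipProcess

end GossipAge

theorem mainTheorem5 {V : Type*} [Finite V] {Ω : Type*} [MeasurableSpace Ω]
    (P : Measure Ω) [IsProbabilityMeasure P]
    (G : Digraph (Option V)) (k n : ℕ) (hk : 1 ≤ k) (hG : GossipAge.IsTSSFeasible G k)
    (keyOf : ℕ → V ≃ Fin n)
    (lamS : ℝ≥0) (hlamS : 0 < lamS)
    (lamE : V → V → ℝ≥0) (hlamE : ∀ i j, G.Adj (some i) (some j) → 0 < lamE i j)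
    (N₀ : ℝ≥0 → Ω → ℕ) (N : V → V → ℝ≥0 → Ω → ℕ)
    (hN : GossipAge.IsGossipProcess G lamS lamE N₀ N P)
    (j : V)
    -- `U` is the length of an arbitrary version cycle, and `X i` is the time between two arbitrary
    -- successive activations of the edge from `i` to `j`
    (l : ℕ) (r : V → ℕ) (U : Ω → ℝ) (X : V → Ω → ℝ)
    (hU : U = fun ω => GossipAge.interarrival (fun t => N₀ t ω) l)
    (hX : X = fun i ω => GossipAge.interarrival (fun t => N i j t ω) (r i))
    (A : ℝ → Ω → ℝ)
    (hA : A = fun s ω => GossipAge.versionAge G k keyOf (fun t => N₀ t ω)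
      (fun i i' t => N i i' t ω) j s.toNNReal) :
    Integrable U P ∧ 0 < ∫ ω, U ω ∂P ∧
    Integrable (fun ω => GossipAge.orderStat (GossipAge.inNeighbors G j) k fun i => X i ω) P ∧
    ∀ᵐ ω ∂P,
      (∀ t : ℝ, 0 ≤ t → IntervalIntegrable (fun s => A s ω) volume 0 t) ∧
      Tendsto (fun t : ℝ => (1 / t) * ∫ s in (0 : ℝ)..t, A s ω) atTop
        (𝓝 ((∫ ω', GossipAge.orderStat (GossipAge.inNeighbors G j) k (fun i => X i ω') ∂P) /
          ∫ ω', U ω' ∂P)) := by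
  subst hU hX hA
  have hkj := hG.le_ncard_inNeighbors j
  have hEU := hN.source.integral_interarrival hlamS l
  refine ⟨hN.source.integrable_interarrival hlamS l, ?_,
    hN.integrable_orderStat hlamE hk hkj r, ?_⟩
  · rw [hEU]
    positivity
  -- Only countably many grids are used, so one null set serves all of them.
  have hgrid : ∀ᵐ ω ∂P, ∀ q : ℕ, 0 < q → _ := ae_all_iff.2 fun q => by
    by_cases hq : 0 < q
    · filter_upwards [hN.ae_exists_grid_bounds (j := j) hlamS hlamE hk hG keyOf r hq] with ω hω
      exact fun _ => hω
    · exact ae_of_all _ fun ω h => absurd h hq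
  filter_upwards [hgrid, hN.source.path_mono] with ω hω hmono
  refine ⟨fun t _ => GossipAge.intervalIntegrable_versionAge hmono 0 t, ?_⟩
  -- Since `E[U] = 1 / lamS`, dividing by it is multiplying by `lamS`.
  rw [hEU, div_div_eq_mul_div, div_one, mul_comm]
  exact GossipAge.tendsto_average_integral_of_grid
    (fun t => GossipAge.versionAge_nonneg hmono t.toNNReal)
    (GossipAge.intervalIntegrable_versionAge hmono) hω
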